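/- Let $k \ge 1$ be fixed. Let $\mathcal{B}$ be a set of one- and two-qubit quantum operations (the basic operations) that contains measurement of a qubit in the computational basis and is universal: every two-qubit unitary operation (in particular $U \otimes I$ and $I \otimes U$ for every one-qubit unitary $U$) is, as a map on density matrices, a finite composition of basic operations applied to these two qubits. A $k$-dimensional non-adaptive nearest-neighbor two-qubit concurrent ($k$-D NANTC) circuit family assigns to every input size $n$ a sequence $S_1, \ldots, S_d$ of finite sets of operations on qubits located at the points of the grid $\mathbb{Z}^k$, such that the operations in each $S_i$ act on pairwise disjoint sets of qubits, each of them is a basic operation applied to one qubit or to two qubits at $\ell_1$-distance $1$ in the grid, and the sequence depends on $n$ only (not on measurement outcomes) and is computable from $n$ in time polynomial in $n$; the whole family uses only finitely many different basic operations. The depth is $d$, the size is $\sum_i |S_i|$, and the width is the number of qubits acted on by the operations in the sets $S_i$. Fanout to $n$ targets is the unitary operation on a control qubit $y$ and targets $x_1, \ldots, x_n$ that maps each basis state $|y, x_1, \ldots, x_n\rangle$ to $|y, x_1 \oplus y, \ldots, x_n \oplus y\rangle$. Theorem. There is a $k$-D NANTC circuit family over $\mathcal{B}$ whose $n$-th circuit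 implements fanout to $n$ targets exactly, for every $n$: for a suitable placement of the control and the $n$ targets at distinct points of $\mathbb{Z}^k$, and with all other qubits of the grid (ancillas) starting in the state $|0\rangle$, the circuit applies fanout to the $n+1$ data qubits, whatever their state, and returns the ancillas to $|0\rangle$. The circuits have depth $O(n^{1/k})$, size $O(n)$ and width $O(n)$ as $n \to \infty$, where the implied constants may depend on $k$ and $\mathcal{B}$. -/

import Mathlib

open Matrix Filter Asymptotics

namespace NANTC

/-! ### Quantum states and operations on qubits indexed by a type `Q` -/

/-- Computational basis states of the qubits indexed by `Q`. -/
abbrev Config (Q : Type) := Q → Bool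

/-- Linear operators on the qubits `Q`, given by their entries in the computational basis
(density matrices are among them).  For infinite `Q`, only operators whose entries vanish unless
all but finitely many qubits are `0` will occur. -/
abbrev State (Q : Type) := Matrix (Config Q) (Config Q) ℂ

/-- Linear maps on operators ("superoperators"). -/
abbrev Superop (Q : Type) := Module.End ℂ (State Q)

/-- A quantum operation, i.e. a completely positive trace preserving map, in Kraus form. -/
def IsQuantumOperation {Q : Type} [Fintype Q] [DecidableEq Q] (E : Superop Q) : Prop :=
  ∃ (r : ℕ) (K : Fin r → State Q),
    ∑ i, (K i)ᴴ * K i = 1 ∧ ∀ ρ, E ρ = ∑ i, K i * ρ * (K i)ᴴ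

/-- Conjugation `ρ ↦ U ρ U†`. -/
def conj {Q : Type} [Fintype Q] [DecidableEq Q] (U : State Q) : Superop Q where
  toFun ρ := U * ρ * Uᴴ
  map_add' ρ σ := by rw [Matrix.mul_add, Matrix.add_mul]
  map_smul' c ρ := by simp

/-- Measurement of one qubit in the computational basis.  As nothing may depend on the outcome,
this is the quantum operation `ρ ↦ ∑ b, |b⟩⟨b| ρ |b⟩⟨b|`. -/
def measurement : Superop (Fin 1) :=
  Matrix.diagonalLinearMap (Config (Fin 1)) ℂ ℂ ∘ₗ Matrix.diagLinearMap (Config (Fin 1)) ℂ ℂ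

/-- `applyAt f E` applies the `m`-qubit map `E` to the qubits `f 0, …, f (m - 1)` of `Q`, and the
identity to all others: it is `E ⊗ id`.  It is meant for injective `f`.
Here `Function.extend f a x` is `x` with the value at `f i` replaced by `a i`. -/
noncomputable def applyAt {Q : Type} {m : ℕ} (f : Fin m → Q) (E : Superop (Fin m)) :
    Superop Q where
  toFun ρ := Matrix.of fun x y =>
    E (Matrix.of fun a b => ρ (Function.extend f a x) (Function.extend f b y)) (x ∘ f) (y ∘ f)
  map_add' ρ σ := by
    ext x y
    have h := E.map_add
      (Matrix.of fun a b => ρ (Function.extend f a x) (Function.extend f b y))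
      (Matrix.of fun a b => σ (Function.extend f a x) (Function.extend f b y))
    exact congrFun (congrFun h (x ∘ f)) (y ∘ f)
  map_smul' c ρ := by
    ext x y
    have h := E.map_smul c
      (Matrix.of fun a b => ρ (Function.extend f a x) (Function.extend f b y))
    exact congrFun (congrFun h (x ∘ f)) (y ∘ f)

/-! ### Basic operations -/

/-- The basic operations of the hardware: one- and two-qubit quantum operations, containing
measurement in the computational basis, from which every two-qubit unitary (in particular every
`U ⊗ 1` and `1 ⊗ U`) can be constructed exactly, by a finite composition of basic operations on
the two qubits (two-qubit operations being applied to them in either order). -/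
structure GateSet where
  one : Set (Superop (Fin 1))
  two : Set (Superop (Fin 2))
  one_isQuantumOperation : ∀ E ∈ one, IsQuantumOperation E
  two_isQuantumOperation : ∀ E ∈ two, IsQuantumOperation E
  measurement_mem : measurement ∈ one
  universal : ∀ U ∈ Matrix.unitaryGroup (Config (Fin 2)) ℂ,
    conj U ∈ Submonoid.closure
      ({T : Superop (Fin 2) | ∃ E ∈ one, ∃ f : Fin 1 → Fin 2, T = applyAt f E} ∪
       {T : Superop (Fin 2) | ∃ E ∈ two, ∃ f : Fin 2 → Fin 2,
          Function.Injective f ∧ T = applyAt f E})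

/-! ### Circuits on the grid `ℤ^k` -/

/-- The points of the `k`-dimensional grid. -/
abbrev Grid (k : ℕ) := Fin k → ℤ

/-- Grid points at `ℓ₁`-distance one. -/
def Neighbors {k : ℕ} (p q : Grid k) : Prop := ∑ i, |p i - q i| = 1

/-- An application of a basic operation to one or two qubits of the grid.  The basic operation is
named by its index in a finite table of `a` one-qubit and `b` two-qubit operations. -/
inductive Instr (k a b : ℕ) where
  | one (g : Fin a) (p : Grid k)
  | two (g : Fin b) (p q : Grid k)

namespace Instr

variable {k a b : ℕ}

/-- The qubits an operation acts on. -/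
def qubits : Instr k a b → List (Grid k)
  | one _ p => [p]
  | two _ p q => [p, q]

/-- Two-qubit operations are only allowed between neighbors. -/
def IsLocal : Instr k a b → Prop
  | one _ _ => True
  | two _ p q => Neighbors p q

/-- The action on states of the grid. -/
noncomputable def eval (G₁ : Fin a → Superop (Fin 1)) (G₂ : Fin b → Superop (Fin 2)) :
    Instr k a b → Superop (Grid k)
  | one g p => applyAt ![p] (G₁ g)
  | two g p q => applyAt ![p, q] (G₂ g)

end Instr

/-- A circuit is a sequence of sets of operations; each set is given as a list. -/
abbrev Circuit (k a b : ℕ) := List (List (Instr k a b))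

namespace Circuit

variable {k a b : ℕ}

/-- In each timestep the operations act on disjoint sets of qubits (in particular they are
distinct, so that a list of them is the same as a set), and they are local. -/
def IsValid (C : Circuit k a b) : Prop :=
  ∀ S ∈ C, S.Pairwise (fun I J => List.Disjoint I.qubits J.qubits) ∧ ∀ I ∈ S, I.IsLocal

/-- The number of timesteps. -/
def depth (C : Circuit k a b) : ℕ := C.length

/-- The total number of operations. -/
def size (C : Circuit k a b) : ℕ := (C.map List.length).sum

/-- The number of qubits acted on. -/
def width (C : Circuit k a b) : ℕ := (C.flatten.flatMap Instr.qubits).toFinset.card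

/-- The state after running the circuit on `ρ`, the first timestep first. (Within a timestep the
order is immaterial, as the operations are on disjoint sets of qubits.) -/
noncomputable def run (G₁ : Fin a → Superop (Fin 1)) (G₂ : Fin b → Superop (Fin 2))
    (C : Circuit k a b) (ρ : State (Grid k)) : State (Grid k) :=
  C.flatten.foldl (fun τ I => I.eval G₁ G₂ τ) ρ

end Circuit

/-! ### Encoding circuits by bit strings (a prefix code) -/

/-- Unary code of a natural number. -/
def encodeNat (n : ℕ) : List Bool := List.replicate n true ++ [false]

/-- Sign and absolute value. -/
def encodeInt (z : ℤ) : List Bool := decide (z < 0) :: encodeNat z.natAbs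

def encodePoint {k : ℕ} (p : Grid k) : List Bool := (List.ofFn p).flatMap encodeInt

def encodeInstr {k a b : ℕ} : Instr k a b → List Bool
  | .one g p => false :: (encodeNat g ++ encodePoint p)
  | .two g p q => true :: (encodeNat g ++ encodePoint p ++ encodePoint q)

def encodeLayer {k a b : ℕ} (S : List (Instr k a b)) : List Bool :=
  S.flatMap (fun I => true :: encodeInstr I) ++ [false]

def encodeCircuit {k a b : ℕ} (C : Circuit k a b) : List Bool :=
  C.flatMap (fun S => true :: encodeLayer S) ++ [false]

/-! ### Polynomial time

The machine model: structured programs over finitely many stacks of bits (a multi-stack machine,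
polynomially equivalent to multi-tape Turing machines), with a step count. -/

/-- Programs; stacks are named by natural numbers (a program mentions only finitely many).
A test compares the top of stack `r` with `t`, where `none` stands for the empty stack. -/
inductive Prog where
  | skip
  | push (r : ℕ) (b : Bool)
  | pop (r : ℕ)
  | seq (p q : Prog)
  | ite (r : ℕ) (t : Option Bool) (p q : Prog)
  | while (r : ℕ) (t : Option Bool) (p : Prog)

/-- Contents of the stacks; the head of a list is the top. -/
abbrev Store := ℕ → List Bool

/-- `Run p s s' t`: started in `s`, the program `p` halts in `s'` after `t` steps. -/
inductive Run : Prog → Store → Store → ℕ → Prop where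
  | skip (s : Store) : Run .skip s s 1
  | push (r : ℕ) (b : Bool) (s : Store) :
      Run (.push r b) s (Function.update s r (b :: s r)) 1
  | pop (r : ℕ) (s : Store) : Run (.pop r) s (Function.update s r (s r).tail) 1
  | seq {p q : Prog} {s s' s'' : Store} {t t' : ℕ} :
      Run p s s' t → Run q s' s'' t' → Run (.seq p q) s s'' (t + t')
  | ite_pos {r : ℕ} {c : Option Bool} {p q : Prog} {s s' : Store} {t : ℕ} :
      (s r).head? = c → Run p s s' t → Run (.ite r c p q) s s' (t + 1)
  | ite_neg {r : ℕ} {c : Option Bool} {p q : Prog} {s s' : Store} {t : ℕ} :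
      (s r).head? ≠ c → Run q s s' t → Run (.ite r c p q) s s' (t + 1)
  | while_done {r : ℕ} {c : Option Bool} {p : Prog} {s : Store} :
      (s r).head? ≠ c → Run (.while r c p) s s 1
  | while_step {r : ℕ} {c : Option Bool} {p : Prog} {s s' s'' : Store} {t t' : ℕ} :
      (s r).head? = c → Run p s s' t → Run (.while r c p) s' s'' t' →
      Run (.while r c p) s s'' (t + t' + 1)

/-- Stack `0` holds `n` in unary, the other stacks are empty. -/
def initStore (n : ℕ) : Store := fun r => if r = 0 then List.replicate n true else []

/-- `F n` is computable from `n` by a (deterministic) program, in a number of steps that is at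
most polynomial in `n`; the result is left on stack `1`. -/
def PolyTimeFromSize (F : ℕ → List Bool) : Prop :=
  ∃ (p : Prog) (P : Polynomial ℕ), ∀ n : ℕ, ∃ (s : Store) (t : ℕ),
    Run p (initStore n) s t ∧ s 1 = F n ∧ t ≤ P.eval n

/-! ### The NANTC model -/

/-- A family of `k`-dimensional NANTC circuits over the basic operations `B`: for every input
size, a sequence of sets of disjoint local basic operations (taken from a finite table, which
gives the circuits a finite description), computable from the input size in polynomial time. -/
structure Family (k : ℕ) (B : GateSet) where
  numOne : ℕ
  numTwo : ℕ
  gateOne : Fin numOne → Superop (Fin 1)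
  gateTwo : Fin numTwo → Superop (Fin 2)
  gateOne_mem : ∀ g, gateOne g ∈ B.one
  gateTwo_mem : ∀ g, gateTwo g ∈ B.two
  circuit : ℕ → Circuit k numOne numTwo
  isValid : ∀ n, (circuit n).IsValid
  uniform : PolyTimeFromSize (fun n => encodeCircuit (circuit n))

open Classical in
/-- The state of the grid in which the data qubits `D`, placed at the points `loc d`, are in the
state `σ`, and all other qubits (the ancillas) are in the state `|0⟩`. -/
noncomputable def place {k : ℕ} {D : Type} (loc : D → Grid k) (σ : State D) : State (Grid k) :=
  Matrix.of fun x y =>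
    if ∀ q, q ∉ Set.range loc → x q = false ∧ y q = false then σ (x ∘ loc) (y ∘ loc) else 0

/-- The circuit for size `n` implements the superoperator `T` on data qubits `D`: for a suitable
placement of the data qubits at distinct grid points, with all ancillas starting in `|0⟩`, the
circuit performs `T` on the data qubits and returns the ancillas to `|0⟩`.
By linearity it is the same to ask this for all operators `σ` or for all density matrices. -/
def Family.Implements {k : ℕ} {B : GateSet} (C : Family k B) (n : ℕ) {D : Type}
    (T : Superop D) : Prop :=
  ∃ loc : D → Grid k, Function.Injective loc ∧
    ∀ σ : State D, (C.circuit n).run C.gateOne C.gateTwo (place loc σ) = place loc (T σ)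

/-! ### Fanout -/

/-- Fanout on basis states: the control `none` is XORed into each of the targets `some j`. -/
def fanoutMap (n : ℕ) (x : Config (Option (Fin n))) : Config (Option (Fin n))
  | none => x none
  | some j => xor (x (some j)) (x none)

/-- The unitary matrix of fanout to `n` targets. -/
def fanoutMatrix (n : ℕ) : State (Option (Fin n)) :=
  Matrix.of fun x y => if x = fanoutMap n y then 1 else 0

/-- The quantum operation of fanout to `n` targets. -/
def fanout (n : ℕ) : Superop (Option (Fin n)) := conj (fanoutMatrix n)

end NANTC

namespace NANTC

/-! ### Superoperators applied to some of the qubits -/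

section applyAt

variable {Q : Type} {m l : ℕ}

/-! Let `s` be the rounded-down `k`-th root of `n`, so that `s ^ k ≤ n < (s + 1) ^ k`. The control
and the targets are numbered `0, …, n` and placed in a cube of side `s + 1`, with the base-`(s + 1)`
digits as coordinates. Lowering the leading digit by one moves a point to a grid neighbor and makes
`0, …, n` a tree with root `0`. Nodes with the same leading digit in the same position form one
layer, so there are `k * s` layers; within a layer the edges are pairwise disjoint
(`treeEdges_pairwise`), and every edge is local (`digitPoint_neighbors`).

Two passes of controlled nots along this tree give fanout. Going from the leaves to the root over
all edges, each `x_N` becomes `x_N ⊕ x_p`, where `p` is the parent and `x_p` still has its old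
value. Going from the root to the leaves over the edges not at the root, each node adds the new
value of its parent, which is `x_p ⊕ x_0` by induction; the two copies of `x_p` cancel and `x_N ⊕
x_0` remains (`foldr_fanoutLayers`). All sites used carry data, so the ancillas are never touched.
There are at most `2 * n` controlled nots in `2 * k * s` layers.

By universality, controlled not is a fixed finite word in basic operations (`exists_word_cnot`). The
letters of the word are applied to all pairs of a layer simultaneously; operations on disjoint pairs
commute, so the letters can be regrouped pair by pair (`prod_wordLayers`). This costs a constant
factor in depth and size.

For uniformity, `Emits` is a small calculus of programs that print a string from unary registers. It
is closed under concatenation, branching, local variables and bounded loops, always with polynomial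
bounds; `EmitsNat` adds the arithmetic needed to print coordinates. The code of the circuit is a
fixed nest of such loops (`encodeCircuit_fanoutCircuit`). -/

theorem applyAt_apply (f : Fin m → Q) (E : Superop (Fin m)) (ρ : State Q) (x y : Config Q) :
    applyAt f E ρ x y =
      E (Matrix.of fun a b => ρ (Function.extend f a x) (Function.extend f b y))
        (x ∘ f) (y ∘ f) := rfl

/-- Expansion in matrix units; it turns `applyAt` into a finite sum against a kernel, where two
applications can be interchanged. -/
theorem superop_apply_eq_sum (E : Superop (Fin m)) (A : State (Fin m)) (a b : Config (Fin m)) :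
    E A a b = ∑ c, ∑ d, E (Matrix.single c d 1) a b * A c d := by
  conv_lhs => rw [Matrix.matrix_eq_sum_single A]
  simp only [map_sum, Matrix.sum_apply]
  refine Finset.sum_congr rfl fun c _ => Finset.sum_congr rfl fun d _ => ?_
  have : Matrix.single c d (A c d) = A c d • Matrix.single c d (1 : ℂ) := by
    rw [Matrix.smul_single, smul_eq_mul, mul_one]
  rw [this, map_smul, Matrix.smul_apply, smul_eq_mul, mul_comm]

theorem applyAt_eq_sum (f : Fin m → Q) (E : Superop (Fin m)) (ρ : State Q) (x y : Config Q) :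
    applyAt f E ρ x y = ∑ c, ∑ d, E (Matrix.single c d 1) (x ∘ f) (y ∘ f) *
      ρ (Function.extend f c x) (Function.extend f d y) :=
  superop_apply_eq_sum E _ _ _

theorem extend_comp_of_disjoint {f : Fin m → Q} {g : Fin l → Q} (h : ∀ i j, f i ≠ g j)
    (a : Config (Fin m)) (x : Config Q) : Function.extend f a x ∘ g = x ∘ g := by
  funext j
  exact Function.extend_apply' _ _ _ fun ⟨i, hi⟩ => h i j hi

theorem extend_extend_of_disjoint {f : Fin m → Q} {g : Fin l → Q} (h : ∀ i j, f i ≠ g j)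
    (a : Config (Fin m)) (b : Config (Fin l)) (x : Config Q) :
    Function.extend f a (Function.extend g b x) = Function.extend g b (Function.extend f a x) := by
  classical
  funext q
  by_cases hf : ∃ i, f i = q
  · have hg : ¬ ∃ j, g j = q := by
      rintro ⟨j, rfl⟩
      obtain ⟨i, hi⟩ := hf
      exact h i j hi
    rw [Function.extend_apply' _ _ _ hg]
    simp only [Function.extend_def, hf, dif_pos]
  · rw [Function.extend_apply' _ _ _ hf]
    by_cases hg : ∃ j, g j = q
    · simp only [Function.extend_def, hg, dif_pos]
    · rw [Function.extend_apply' _ _ _ hg, Function.extend_apply' _ _ _ hg,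
        Function.extend_apply' _ _ _ hf]

/-- Neither substitution affects the bits read by the other kernel, and the substitutions commute,
so both orders give the same fourfold sum. -/
theorem applyAt_commute {f : Fin m → Q} {g : Fin l → Q} (h : ∀ i j, f i ≠ g j)
    (E : Superop (Fin m)) (F : Superop (Fin l)) : Commute (applyAt f E) (applyAt g F) := by
  refine LinearMap.ext fun ρ => ?_
  ext x y
  change applyAt f E (applyAt g F ρ) x y = applyAt g F (applyAt f E ρ) x y
  have hgf : ∀ i j, g i ≠ f j := fun i j e => h j i e.symm
  simp only [applyAt_eq_sum,
    extend_comp_of_disjoint h, extend_comp_of_disjoint hgf, extend_extend_of_disjoint hgf,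
    Finset.mul_sum]
  have comm4 : ∀ G : Config (Fin m) → Config (Fin m) → Config (Fin l) → Config (Fin l) → ℂ,
      ∑ a, ∑ b, ∑ c, ∑ d, G a b c d = ∑ c, ∑ d, ∑ a, ∑ b, G a b c d := by
    intro G
    calc _ = ∑ a, ∑ c, ∑ b, ∑ d, G a b c d :=
          Finset.sum_congr rfl fun _ _ => Finset.sum_comm
      _ = ∑ c, ∑ a, ∑ b, ∑ d, G a b c d := Finset.sum_comm
      _ = ∑ c, ∑ a, ∑ d, ∑ b, G a b c d :=
          Finset.sum_congr rfl fun _ _ => Finset.sum_congr rfl fun _ _ => Finset.sum_comm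
      _ = _ := Finset.sum_congr rfl fun _ _ => Finset.sum_comm
  rw [comm4]
  refine Finset.sum_congr rfl fun _ _ => Finset.sum_congr rfl fun _ _ =>
    Finset.sum_congr rfl fun _ _ => Finset.sum_congr rfl fun _ _ => by ring

theorem extend_comp_self {f : Fin m → Q} (hf : Function.Injective f) (a : Config (Fin m))
    (x : Config Q) : Function.extend f a x ∘ f = a :=
  funext fun i => hf.extend_apply a x i

theorem extend_extend_self {f : Fin m → Q} (hf : Function.Injective f) (a b : Config (Fin m))
    (x : Config Q) : Function.extend f a (Function.extend f b x) = Function.extend f a x := by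
  funext q
  by_cases h : ∃ i, f i = q
  · obtain ⟨i, rfl⟩ := h
    rw [hf.extend_apply, hf.extend_apply]
  · simp only [Function.extend_apply' _ _ _ h]

theorem extend_self_comp {f : Fin m → Q} (hf : Function.Injective f) (x : Config Q) :
    Function.extend f (x ∘ f) x = x := by
  funext q
  by_cases h : ∃ i, f i = q
  · obtain ⟨i, rfl⟩ := h
    rw [hf.extend_apply, Function.comp_apply]
  · rw [Function.extend_apply' _ _ _ h]

/-- `applyAt f` as a homomorphism of monoids. -/
noncomputable def applyAtHom (f : Fin m → Q) (hf : Function.Injective f) :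
    Superop (Fin m) →* Superop Q where
  toFun := applyAt f
  map_one' := by
    refine LinearMap.ext fun ρ => ?_
    ext x y
    simp only [applyAt_apply, Module.End.one_apply, Matrix.of_apply, extend_self_comp hf]
  map_mul' E F := by
    refine LinearMap.ext fun ρ => ?_
    ext x y
    simp only [applyAt_apply, Module.End.mul_apply, extend_comp_self hf, extend_extend_self hf]
    rfl

theorem applyAt_applyAt {f : Fin m → Q} (hf : Function.Injective f) {g : Fin l → Fin m}
    (hg : Function.Injective g) (E : Superop (Fin l)) :
    applyAt f (applyAt g E) = applyAt (f ∘ g) E := by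
  have key : ∀ (a : Config (Fin l)) (x : Config Q),
      Function.extend f (Function.extend g a (x ∘ f)) x = Function.extend (f ∘ g) a x := by
    intro a x
    funext q
    by_cases h : ∃ i, f i = q
    · obtain ⟨i, rfl⟩ := h
      rw [hf.extend_apply]
      by_cases h' : ∃ j, g j = i
      · obtain ⟨j, rfl⟩ := h'
        rw [hg.extend_apply]
        exact ((hf.comp hg).extend_apply a x j).symm
      · rw [Function.extend_apply' _ _ _ h', Function.extend_apply']
        · rfl
        · rintro ⟨j, hj⟩
          exact h' ⟨j, hf hj⟩
    · rw [Function.extend_apply' _ _ _ h, Function.extend_apply']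
      rintro ⟨j, hj⟩
      exact h ⟨g j, hj⟩
  refine LinearMap.ext fun ρ => ?_
  ext x y
  simp only [applyAt_apply, Matrix.of_apply, key]
  rfl

end applyAt

/-! ### Permutations of the computational basis -/

section Pullback

variable {Q : Type}

/-- The superoperator that relabels basis states by `φ`. -/
def pullback (φ : Config Q → Config Q) : Superop Q where
  toFun ρ := Matrix.of fun x y => ρ (φ x) (φ y)
  map_add' _ _ := rfl
  map_smul' _ _ := rfl

theorem pullback_apply (φ : Config Q → Config Q) (ρ : State Q) (x y : Config Q) :
    pullback φ ρ x y = ρ (φ x) (φ y) := rfl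

/-- Conjugation relabels entries by the inverse permutation; for an involution no inverse is
visible. -/
theorem conj_perm [Fintype Q] [DecidableEq Q] {π : Config Q → Config Q}
    (hπ : Function.Involutive π) :
    conj (Matrix.of fun x y => if x = π y then (1 : ℂ) else 0) = pullback π := by
  refine LinearMap.ext fun ρ => ?_
  ext x y
  have h : ∀ a b, a = π b ↔ b = π a := fun a b =>
    ⟨fun e => by rw [e, hπ], fun e => by rw [e, hπ]⟩
  change _ = ρ (π x) (π y)
  simp [conj, Matrix.mul_apply, h x, h y, apply_ite (star : ℂ → ℂ)]

theorem perm_mem_unitaryGroup [Fintype Q] [DecidableEq Q] {π : Config Q → Config Q}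
    (hπ : Function.Involutive π) :
    (Matrix.of fun x y => if x = π y then (1 : ℂ) else 0 : State Q) ∈
      Matrix.unitaryGroup (Config Q) ℂ := by
  have h : ∀ a b, a = π b ↔ b = π a := fun a b =>
    ⟨fun e => by rw [e, hπ], fun e => by rw [e, hπ]⟩
  rw [Matrix.mem_unitaryGroup_iff]
  ext x y
  simp [Matrix.mul_apply, Matrix.star_eq_conjTranspose, h x, h y, apply_ite (star : ℂ → ℂ),
    Matrix.one_apply, hπ.injective.eq_iff, eq_comm]

/-- Controlled not, with control `p` and target `q`, on basis states. -/
def cnot [DecidableEq Q] (p q : Q) (x : Config Q) : Config Q :=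
  Function.update x q (xor (x q) (x p))

theorem cnot_involutive [DecidableEq Q] {p q : Q} (h : p ≠ q) :
    Function.Involutive (cnot p q : Config Q → Config Q) := by
  intro x
  funext r
  by_cases hr : r = q
  · subst hr; simp [cnot, h]
  · simp [cnot, hr]

theorem injective_pair {p q : Q} (h : p ≠ q) : Function.Injective ![p, q] := by
  intro i j
  fin_cases i <;> fin_cases j <;> simp [h, h.symm]

theorem applyAt_pullback_cnot [DecidableEq Q] {p q : Q} (h : p ≠ q) :
    applyAt ![p, q] (pullback (cnot 0 1)) = pullback (cnot p q) := by
  have key : ∀ x : Config Q,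
      Function.extend ![p, q] (cnot 0 1 (x ∘ ![p, q])) x = cnot p q x := by
    intro x
    funext r
    have hinj := injective_pair h
    by_cases hp : r = p
    · subst hp
      have := hinj.extend_apply (cnot 0 1 (x ∘ ![r, q])) x 0
      simpa [cnot, h] using this
    · by_cases hq : r = q
      · subst hq
        have := hinj.extend_apply (cnot 0 1 (x ∘ ![p, r])) x 1
        simpa [cnot] using this
      · rw [Function.extend_apply']
        · simp [cnot, hq]
        · rintro ⟨i, hi⟩
          fin_cases i
          · exact hp hi.symm
          · exact hq hi.symm
  refine LinearMap.ext fun ρ => ?_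
  ext x y
  simp only [applyAt_apply, pullback_apply, Matrix.of_apply, key]

end Pullback

/-! ### Words of basic operations -/

/-- A basic operation on an ordered pair of qubits, named by its index in a table; the boolean
says which qubit it acts on, or whether the qubits are swapped. -/
abbrev Letter (a b : ℕ) := (Fin a × Bool) ⊕ (Fin b × Bool)

/-- The application of a letter to a pair of grid points. -/
def Letter.instr {k a b : ℕ} : Letter a b → Grid k → Grid k → Instr k a b
  | .inl (g, c), p, q => .one g (if c then q else p)
  | .inr (g, c), p, q => if c then .two g q p else .two g p q

/-- The superoperator on two qubits that a letter stands for. -/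
noncomputable def Letter.eval {a b : ℕ} (G₁ : Fin a → Superop (Fin 1))
    (G₂ : Fin b → Superop (Fin 2)) : Letter a b → Superop (Fin 2)
  | .inl (g, c) => applyAt (fun _ => if c then 1 else 0) (G₁ g)
  | .inr (g, c) => applyAt (if c then ![1, 0] else ![0, 1]) (G₂ g)

theorem Letter.eval_instr {k a b : ℕ} (G₁ : Fin a → Superop (Fin 1))
    (G₂ : Fin b → Superop (Fin 2)) (L : Letter a b) {p q : Grid k} (h : p ≠ q) :
    (L.instr p q).eval G₁ G₂ = applyAt ![p, q] (L.eval G₁ G₂) := by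
  have hinj := injective_pair h
  have h01 : Function.Injective (![0, 1] : Fin 2 → Fin 2) := injective_pair (by decide)
  have h10 : Function.Injective (![1, 0] : Fin 2 → Fin 2) := injective_pair (by decide)
  match L with
  | .inl (g, c) =>
    rw [Letter.eval, applyAt_applyAt hinj (Function.injective_of_subsingleton _)]
    simp only [Letter.instr, Instr.eval]
    congr 1
    funext i
    cases c <;> simp [Subsingleton.elim i 0]
  | .inr (g, true) =>
    simp only [Letter.eval, Letter.instr, Instr.eval, if_true]
    rw [applyAt_applyAt hinj h10]
    congr 1
    funext i
    fin_cases i <;> rfl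
  | .inr (g, false) =>
    simp only [Letter.eval, Letter.instr, Instr.eval]
    rw [if_neg (by decide), if_neg (by decide), applyAt_applyAt hinj h01]
    change applyAt ![p, q] (G₂ g) = _
    congr 1
    funext i
    fin_cases i <;> rfl

theorem Letter.qubits_instr_subset {k a b : ℕ} (L : Letter a b) (p q : Grid k) :
    ∀ r ∈ (L.instr p q).qubits, r = p ∨ r = q := by
  match L with
  | .inl (g, c) => cases c <;> simp [Letter.instr, Instr.qubits]
  | .inr (g, c) => cases c <;> simp [Letter.instr, Instr.qubits, or_comm]

theorem Neighbors.symm {k : ℕ} {p q : Grid k} (h : Neighbors p q) : Neighbors q p := by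
  simpa only [Neighbors, abs_sub_comm] using h

theorem Neighbors.ne {k : ℕ} {p q : Grid k} (h : Neighbors p q) : p ≠ q := by
  rintro rfl
  simp [Neighbors] at h

theorem Letter.isLocal_instr {k a b : ℕ} (L : Letter a b) {p q : Grid k} (h : Neighbors p q) :
    (L.instr p q).IsLocal := by
  match L with
  | .inl (g, c) => trivial
  | .inr (g, true) => exact h.symm
  | .inr (g, false) => exact h

/-- Controlled not is a word over a finite table of basic operations; the first letter is applied
first. -/
theorem exists_word_cnot (B : GateSet) :
    ∃ (a b : ℕ) (G₁ : Fin a → Superop (Fin 1)) (G₂ : Fin b → Superop (Fin 2))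
      (w : List (Letter a b)), (∀ g, G₁ g ∈ B.one) ∧ (∀ g, G₂ g ∈ B.two) ∧
      (w.map fun L => MulOpposite.op (L.eval G₁ G₂)).prod =
        MulOpposite.op (pullback (cnot 0 1)) := by
  classical
  have hinv := cnot_involutive (Q := Fin 2) (p := 0) (q := 1) (by decide)
  have huniv := B.universal _ (perm_mem_unitaryGroup hinv)
  rw [conj_perm hinv] at huniv
  obtain ⟨l, hl, hprod⟩ := Submonoid.exists_list_of_mem_closure huniv
  -- The induction only collects the operations used and finds a word over any tables containing
  -- them; hence enlarging the collection never requires reindexing an earlier word.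
  suffices H : ∀ l : List (Superop (Fin 2)), (∀ T ∈ l, T ∈
      ({T : Superop (Fin 2) | ∃ E ∈ B.one, ∃ f : Fin 1 → Fin 2, T = applyAt f E} ∪
       {T : Superop (Fin 2) | ∃ E ∈ B.two, ∃ f : Fin 2 → Fin 2,
          Function.Injective f ∧ T = applyAt f E})) →
      ∃ (L₁ : List (Superop (Fin 1))) (L₂ : List (Superop (Fin 2))),
        (∀ E ∈ L₁, E ∈ B.one) ∧ (∀ E ∈ L₂, E ∈ B.two) ∧
        ∀ (a b : ℕ) (G₁ : Fin a → Superop (Fin 1)) (G₂ : Fin b → Superop (Fin 2)),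
          (∀ E ∈ L₁, ∃ g, G₁ g = E) → (∀ E ∈ L₂, ∃ g, G₂ g = E) →
          ∃ w : List (Letter a b), w.map (Letter.eval G₁ G₂) = l by
    obtain ⟨L₁, L₂, h₁, h₂, hw⟩ := H l hl
    obtain ⟨w, hw⟩ := hw L₁.length L₂.length L₁.get L₂.get
      (fun E hE => List.mem_iff_get.1 hE) (fun E hE => List.mem_iff_get.1 hE)
    -- In a product of endomorphisms the last factor acts first, whereas a word begins with the
    -- letter that acts first.
    refine ⟨L₁.length, L₂.length, L₁.get, L₂.get, w.reverse,
      fun g => h₁ _ (L₁.get_mem g), fun g => h₂ _ (L₂.get_mem g), ?_⟩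
    rw [← hprod, ← hw, MulOpposite.op_list_prod, List.map_reverse, List.map_map]
    rfl
  intro l
  induction l with
  | nil => exact fun _ => ⟨[], [], by simp, by simp, fun _ _ _ _ _ _ => ⟨[], rfl⟩⟩
  | cons T l ih =>
    intro hT
    obtain ⟨L₁, L₂, h₁, h₂, hw⟩ := ih fun S hS => hT S (by simp [hS])
    rcases hT T (by simp) with ⟨E, hE, f, rfl⟩ | ⟨E, hE, f, hf, rfl⟩
    · refine ⟨E :: L₁, L₂, by simpa using ⟨hE, h₁⟩, h₂, fun a b G₁ G₂ hG₁ hG₂ => ?_⟩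
      obtain ⟨w, hw⟩ := hw a b G₁ G₂ (fun F hF => hG₁ F (by simp [hF])) hG₂
      obtain ⟨g, rfl⟩ := hG₁ E (by simp)
      refine ⟨.inl (g, decide (f 0 = 1)) :: w, ?_⟩
      rw [List.map_cons, hw, Letter.eval]
      congr 2
      funext i
      rw [Subsingleton.elim i 0]
      rcases Fin.exists_fin_two.1 ⟨f 0, rfl⟩ with h | h <;> simp [h]
    · refine ⟨L₁, E :: L₂, h₁, by simpa using ⟨hE, h₂⟩, fun a b G₁ G₂ hG₁ hG₂ => ?_⟩
      obtain ⟨w, hw⟩ := hw a b G₁ G₂ hG₁ fun F hF => hG₂ F (by simp [hF])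
      obtain ⟨g, rfl⟩ := hG₂ E (by simp)
      refine ⟨.inr (g, decide (f 0 = 1)) :: w, ?_⟩
      rw [List.map_cons, hw, Letter.eval]
      congr 2
      have h01 : f 0 ≠ f 1 := fun e => absurd (hf e) (by decide)
      rcases Fin.exists_fin_two.1 ⟨f 0, rfl⟩ with h | h
      · have h' : f 1 = 1 := by
          rcases Fin.exists_fin_two.1 ⟨f 1, rfl⟩ with h' | h'
          · exact absurd (h.trans h'.symm) h01
          · exact h'
        funext i
        fin_cases i <;> simp [h, h']
      · have h' : f 1 = 0 := by
          rcases Fin.exists_fin_two.1 ⟨f 1, rfl⟩ with h' | h'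
          · exact h'
          · exact absurd (h.trans h'.symm) h01
        funext i
        fin_cases i <;> simp [h, h']

/-! ### Running circuits -/

section Run

variable {k a b : ℕ} (G₁ : Fin a → Superop (Fin 1)) (G₂ : Fin b → Superop (Fin 2))

/-- The opposite monoid lets the product be written in the order of time. -/
theorem run_eq_prod (C : Circuit k a b) (ρ : State (Grid k)) :
    C.run G₁ G₂ ρ =
      (C.flatten.map fun I => MulOpposite.op (I.eval G₁ G₂)).prod.unop ρ := by
  unfold Circuit.run
  generalize C.flatten = l
  induction l generalizing ρ with
  | nil => rfl
  | cons I l ih => simp [ih]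

/-- The timesteps that apply the word `w` to all the pairs `S` simultaneously. -/
def wordLayers (w : List (Letter a b)) (S : List (Grid k × Grid k)) : Circuit k a b :=
  w.map fun L => S.map fun e => L.instr e.1 e.2

theorem prod_map_mul_of_commute {α M : Type*} [Monoid M] (l : List α) (x y : α → M)
    (h : ∀ s ∈ l, ∀ t ∈ l, Commute (x s) (y t)) :
    (l.map fun t => x t * y t).prod = (l.map x).prod * (l.map y).prod := by
  induction l with
  | nil => simp
  | cons t l ih =>
    have hc : Commute (y t) (l.map x).prod := Commute.list_prod_right _ _ fun z hz => by
      obtain ⟨s, hs, rfl⟩ := List.mem_map.1 hz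
      exact (h s (by simp [hs]) t (by simp)).symm
    simp only [List.map_cons, List.prod_cons]
    rw [ih fun s hs t ht => h s (by simp [hs]) t (by simp [ht]), mul_assoc, mul_assoc,
      ← mul_assoc (y t), hc.eq, mul_assoc]

/-- Exchange of a product over time with a product over places: only factors at different places
have to pass each other, while the order in time at each place is kept. -/
theorem prod_map_prod_comm_of_commute {α β M : Type*} [Monoid M] (l : List α) (s : List β)
    (x : α → β → M) (h : s.Pairwise fun e f => ∀ t u, Commute (x t e) (x u f)) :
    (l.map fun t => (s.map (x t)).prod).prod = (s.map fun e => (l.map fun t => x t e).prod).prod := by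
  induction s with
  | nil => simp
  | cons e s ih =>
    rw [List.pairwise_cons] at h
    simp only [List.map_cons, List.prod_cons]
    rw [prod_map_mul_of_commute, ih h.2]
    intro t _ u _
    refine Commute.list_prod_right _ _ fun z hz => ?_
    obtain ⟨f, hf, rfl⟩ := List.mem_map.1 hz
    exact h.1 f hf t u

/-- Pairs of points that have no point in common. -/
def DisjointPairs (e f : Grid k × Grid k) : Prop :=
  e.1 ≠ f.1 ∧ e.1 ≠ f.2 ∧ e.2 ≠ f.1 ∧ e.2 ≠ f.2

theorem prod_wordLayers {w : List (Letter a b)}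
    (hw : (w.map fun L => MulOpposite.op (L.eval G₁ G₂)).prod =
      MulOpposite.op (pullback (cnot 0 1)))
    {S : List (Grid k × Grid k)} (hS : S.Pairwise DisjointPairs) (hne : ∀ e ∈ S, e.1 ≠ e.2) :
    ((wordLayers w S).flatten.map fun I => MulOpposite.op (I.eval G₁ G₂)).prod =
      (S.map fun e => MulOpposite.op (pullback (cnot e.1 e.2))).prod := by
  have h1 : ((wordLayers w S).flatten.map fun I => MulOpposite.op (I.eval G₁ G₂)).prod =
      (w.map fun L => (S.map fun e =>
        MulOpposite.op (applyAt ![e.1, e.2] (L.eval G₁ G₂))).prod).prod := by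
    rw [List.map_flatten, List.prod_flatten, wordLayers, List.map_map, List.map_map]
    congr 1
    refine List.map_congr_left fun L _ => ?_
    simp only [Function.comp_apply, List.map_map]
    congr 1
    refine List.map_congr_left fun e he => ?_
    simp only [Function.comp_apply, L.eval_instr G₁ G₂ (hne e he)]
  rw [h1, prod_map_prod_comm_of_commute]
  · congr 1
    refine List.map_congr_left fun e he => ?_
    have h2 := congrArg (MonoidHom.op (applyAtHom ![e.1, e.2] (injective_pair (hne e he)))) hw
    rw [map_list_prod, List.map_map] at h2
    rw [← applyAt_pullback_cnot (hne e he)]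
    exact h2
  · refine hS.imp fun {e f} hef L L' => Commute.op (applyAt_commute ?_ _ _)
    obtain ⟨h1, h2, h3, h4⟩ := hef
    intro i j
    fin_cases i <;> fin_cases j <;> simp [*]

/-- Pullback is contravariant: the gate that is first in time becomes the outermost map on labels.
Hence `foldr`, under which the labels meet the gates in reverse order of time. -/
theorem run_flatMap_wordLayers {w : List (Letter a b)}
    (hw : (w.map fun L => MulOpposite.op (L.eval G₁ G₂)).prod =
      MulOpposite.op (pullback (cnot 0 1)))
    {l : List (List (Grid k × Grid k))} (hl : ∀ S ∈ l, S.Pairwise DisjointPairs)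
    (hne : ∀ S ∈ l, ∀ e ∈ S, e.1 ≠ e.2) (ρ : State (Grid k)) :
    Circuit.run G₁ G₂ (l.flatMap (wordLayers w)) ρ =
      pullback (fun x => l.flatten.foldr (fun e x => cnot e.1 e.2 x) x) ρ := by
  have h : ((l.flatMap (wordLayers w)).flatten.map fun I =>
      MulOpposite.op (I.eval G₁ G₂)).prod =
      MulOpposite.op (pullback fun x => l.flatten.foldr (fun e x => cnot e.1 e.2 x) x) := by
    have h1 : ((l.flatMap (wordLayers w)).flatten.map fun I =>
        MulOpposite.op (I.eval G₁ G₂)).prod =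
        (l.flatten.map fun e => MulOpposite.op (pullback (cnot e.1 e.2))).prod := by
      induction l with
      | nil => rfl
      | cons S l ih =>
        rw [List.flatMap_cons, List.flatten_append, List.map_append, List.prod_append,
          List.flatten_cons, List.map_append, List.prod_append,
          prod_wordLayers G₁ G₂ hw (hl S (by simp)) (hne S (by simp)),
          ih (fun T hT => hl T (by simp [hT])) fun T hT => hne T (by simp [hT])]
    rw [h1]
    generalize l.flatten = s
    induction s with
    | nil => rfl
    | cons e s ih =>
      rw [List.map_cons, List.prod_cons, ih]
      rfl
  rw [run_eq_prod, h, MulOpposite.unop_op]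

end Run

/-! ### Programs that emit strings -/

/-- The store with the string `out` on stack `1` and the numbers `e r`, in unary, on the others. -/
def unaryStore (out : List Bool) (e : ℕ → ℕ) : Store :=
  fun r => if r = 1 then out else List.replicate (e r) true

theorem run_pop_register (out : List Bool) (e : ℕ → ℕ) {r : ℕ} (hr : r ≠ 1) :
    Run (.pop r) (unaryStore out e) (unaryStore out (Function.update e r (e r - 1))) 1 := by
  convert Run.pop r (unaryStore out e) using 1
  funext q
  by_cases hq : q = r
  · subst hq; simp [unaryStore, hr]
  · simp [unaryStore, Function.update_of_ne hq]

theorem run_push_register (out : List Bool) (e : ℕ → ℕ) {r : ℕ} (hr : r ≠ 1) :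
    Run (.push r true) (unaryStore out e)
      (unaryStore out (Function.update e r (e r + 1))) 1 := by
  convert Run.push r true (unaryStore out e) using 1
  funext q
  by_cases hq : q = r
  · subst hq; simp [unaryStore, hr, List.replicate_succ]
  · simp [unaryStore, Function.update_of_ne hq]

theorem run_push_output (b : Bool) (out : List Bool) (e : ℕ → ℕ) :
    Run (.push 1 b) (unaryStore out e) (unaryStore (b :: out) e) 1 := by
  convert Run.push 1 b (unaryStore out e) using 1
  funext q
  by_cases hq : q = 1
  · subst hq; simp [unaryStore]
  · simp [unaryStore, hq]

theorem run_pop_output (b : Bool) (out : List Bool) (e : ℕ → ℕ) :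
    Run (.pop 1) (unaryStore (b :: out) e) (unaryStore out e) 1 := by
  convert Run.pop 1 (unaryStore (b :: out) e) using 1
  funext q
  by_cases hq : q = 1
  · subst hq; simp [unaryStore]
  · simp [unaryStore, hq]

theorem head?_register (out : List Bool) (e : ℕ → ℕ) {r : ℕ} (hr : r ≠ 1) :
    (unaryStore out e r).head? = some true ↔ e r ≠ 0 := by
  simp only [unaryStore, hr, if_false]
  cases e r <;> simp [List.replicate_succ]

/-- A loop that passes through the states `f N, …, f 0`. -/
theorem run_while (r : ℕ) (c : Option Bool) (p : Prog) (f : ℕ → Store) (T N : ℕ)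
    (h0 : (f 0 r).head? ≠ c)
    (hs : ∀ x < N, (f (x + 1) r).head? = c ∧ ∃ t ≤ T, Run p (f (x + 1)) (f x) t) :
    ∃ t ≤ N * (T + 1) + 1, Run (.while r c p) (f N) (f 0) t := by
  induction N with
  | zero => exact ⟨1, by simp, .while_done h0⟩
  | succ N ih =>
    obtain ⟨t, ht, hrun⟩ := ih fun x hx => hs x (by omega)
    obtain ⟨hc, t', ht', hrun'⟩ := hs N (by omega)
    exact ⟨t' + t + 1, by rw [Nat.succ_mul]; omega, .while_step hc hrun' hrun⟩

/-- A program pushes the string `F e` onto stack `1` in polynomial time, where `e` is given by the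
unary contents of the registers below `d`; it leaves these unchanged, and the registers from `d` on
are empty before and after. -/
def Emits (d : ℕ) (F : (ℕ → ℕ) → List Bool) : Prop :=
  ∃ (p : Prog) (P : Polynomial ℕ), ∀ (M : ℕ) (e : ℕ → ℕ) (out : List Bool),
    (∀ i, e i ≤ M) → (∀ i, d ≤ i → e i = 0) →
    (F e).length ≤ P.eval M ∧
      ∃ t ≤ P.eval M, Run p (unaryStore out e) (unaryStore (F e ++ out) e) t

theorem Emits.nil (d : ℕ) : Emits d fun _ => [] :=
  ⟨.skip, 1, fun _ _ _ _ _ => ⟨by simp, 1, by simp, .skip _⟩⟩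

/-- Output grows at the top of its stack, so strings are built from the back and the program for `G`
has to run first. -/
theorem Emits.append {d : ℕ} {F G : (ℕ → ℕ) → List Bool} (hF : Emits d F) (hG : Emits d G) :
    Emits d fun e => F e ++ G e := by
  obtain ⟨p, P, hp⟩ := hF
  obtain ⟨q, R, hq⟩ := hG
  refine ⟨.seq q p, P + R, fun M e out hM he => ?_⟩
  obtain ⟨hl, t, ht, hr⟩ := hq M e out hM he
  obtain ⟨hl', t', ht', hr'⟩ := hp M e (G e ++ out) hM he
  simp only [Polynomial.eval_add, List.length_append, List.append_assoc]
  exact ⟨by omega, t + t', by omega, .seq hr hr'⟩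

theorem Emits.singleton (d : ℕ) (b : Bool) : Emits d fun _ => [b] :=
  ⟨.push 1 b, 1, fun _ e out _ _ => ⟨by simp, 1, by simp, run_push_output b out e⟩⟩

theorem Emits.const (d : ℕ) (l : List Bool) : Emits d fun _ => l := by
  induction l with
  | nil => exact .nil d
  | cons b l ih => exact (Emits.singleton d b).append ih

theorem Emits.flatMap_const {α : Type} {d : ℕ} (l : List α) {F : α → (ℕ → ℕ) → List Bool}
    (h : ∀ a ∈ l, Emits d (F a)) : Emits d fun e => l.flatMap fun a => F a e := by
  induction l with
  | nil => exact .nil d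
  | cons a l ih =>
    simp only [List.flatMap_cons]
    exact (h a (by simp)).append (ih fun b hb => h b (by simp [hb]))

/-- A stack can be read only by emptying it: register `i` is drained into the output and the free
register `d` at once, then refilled from `d`. -/
theorem Emits.var {d i : ℕ} (hd : 2 ≤ d) (hi : i < d) (hi1 : i ≠ 1) :
    Emits d fun e => List.replicate (e i) true := by
  refine ⟨.seq (.while i (some true) (.seq (.pop i) (.seq (.push d true) (.push 1 true))))
    (.while d (some true) (.seq (.pop d) (.push i true))),
    7 * Polynomial.X + 2, fun M e out hM he => ?_⟩
  have hd1 : d ≠ 1 := by omega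
  have hid : i ≠ d := by omega
  have hMi := hM i
  have hed := he d le_rfl
  obtain ⟨t, ht, hr⟩ := run_while i (some true)
    (.seq (.pop i) (.seq (.push d true) (.push 1 true)))
    (fun x => unaryStore (List.replicate (e i - x) true ++ out)
      (Function.update (Function.update e i x) d (e i - x))) 3 (e i)
    (by simp [head?_register _ _ hi1, hid])
    (fun x hx => ⟨by simp [head?_register _ _ hi1, hid], 3, le_rfl, by
      refine .seq (t := 1) (run_pop_register _ _ hi1)
        (.seq (t := 1) (t' := 1) (run_push_register _ _ hd1) ?_)
      convert run_push_output true _ _ using 2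
      · rw [← List.cons_append, ← List.replicate_succ]
        congr 2; omega
      · funext q
        simp only [Function.update_apply]
        split_ifs <;> omega⟩)
  obtain ⟨t', ht', hr'⟩ := run_while d (some true) (.seq (.pop d) (.push i true))
    (fun x => unaryStore (List.replicate (e i) true ++ out)
      (Function.update (Function.update e i (e i - x)) d x)) 2 (e i)
    (by simp [head?_register _ _ hd1])
    (fun x hx => ⟨by simp [head?_register _ _ hd1], 2, le_rfl, by
      refine .seq (t := 1) (t' := 1) (run_pop_register _ _ hd1) ?_
      convert run_push_register _ _ hi1 using 2
      funext q
      simp only [Function.update_apply]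
      split_ifs <;> omega⟩)
  refine ⟨by simp; omega, t + t', ?_, ?_⟩
  · simp; omega
  · have e1 : Function.update (Function.update e i (e i)) d 0 = e := by
      rw [Function.update_eq_self, ← hed, Function.update_eq_self]
    simp only [Nat.sub_self, Nat.sub_zero, List.replicate_zero, List.nil_append, e1]
      at hr hr'
    exact .seq hr hr'

/-- Emptying a register. -/
theorem run_clear (out : List Bool) (e : ℕ → ℕ) {d : ℕ} (hd : d ≠ 1) (hed : e d = 0) (v : ℕ) :
    ∃ t ≤ 2 * v + 1, Run (.while d (some true) (.pop d))
      (unaryStore out (Function.update e d v)) (unaryStore out e) t := by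
  obtain ⟨t, ht, hr⟩ := run_while d (some true) (.pop d)
    (fun x => unaryStore out (Function.update e d x)) 1 v
    (by simp [head?_register _ _ hd])
    (fun x hx => ⟨by simp [head?_register _ _ hd], 1, le_rfl, by
      convert run_pop_register _ _ hd using 2; simp⟩)
  refine ⟨t, by omega, ?_⟩
  have : Function.update e d 0 = e := by rw [← hed, Function.update_eq_self]
  simpa only [this] using hr

/-- Storing an emitted number in a new register. -/
theorem Emits.store {d : ℕ} (hd : 2 ≤ d) {g : (ℕ → ℕ) → ℕ}
    (hg : Emits d fun e => List.replicate (g e) true) :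
    ∃ (p : Prog) (P : Polynomial ℕ), ∀ (M : ℕ) (e : ℕ → ℕ) (out : List Bool),
      (∀ i, e i ≤ M) → (∀ i, d ≤ i → e i = 0) → g e ≤ P.eval M ∧
      ∃ t ≤ P.eval M, Run p (unaryStore out e)
        (unaryStore out (Function.update e d (g e))) t := by
  obtain ⟨p, P, hp⟩ := hg
  -- The bit `false` separates the number from earlier output, so that the loop moving it to
  -- register `d` stops in time.
  refine ⟨.seq (.push 1 false) (.seq p (.seq
    (.while 1 (some true) (.seq (.pop 1) (.push d true))) (.pop 1))),
    4 * P + 3, fun M e out hM he => ?_⟩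
  obtain ⟨hl, t, ht, hr⟩ := hp M e (false :: out) hM he
  have hd1 : d ≠ 1 := by omega
  have hed := he d le_rfl
  simp only [List.length_replicate] at hl
  obtain ⟨t', ht', hr'⟩ := run_while 1 (some true) (.seq (.pop 1) (.push d true))
    (fun x => unaryStore (List.replicate x true ++ false :: out)
      (Function.update e d (g e - x))) 2 (g e)
    (by simp [unaryStore])
    (fun x hx => ⟨by simp [unaryStore, List.replicate_succ], 2, le_rfl, by
      rw [List.replicate_succ, List.cons_append]
      refine .seq (t := 1) (t' := 1) (run_pop_output _ _ _) ?_
      convert run_push_register _ _ hd1 using 2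
      funext q
      simp only [Function.update_apply]
      split_ifs <;> omega⟩)
  have e1 : Function.update e d (g e - g e) = e := by
    rw [Nat.sub_self, ← hed, Function.update_eq_self]
  simp only [e1, Nat.sub_zero, List.replicate_zero, List.nil_append] at hr'
  refine ⟨by simp; omega, 1 + (t + (t' + 1)), by simp; omega,
    .seq (run_push_output _ _ _) (.seq hr (.seq hr' (run_pop_output _ _ _)))⟩

theorem Emits.letVar {d : ℕ} (hd : 2 ≤ d) {g : (ℕ → ℕ) → ℕ} {F : (ℕ → ℕ) → List Bool}
    (hg : Emits d fun e => List.replicate (g e) true) (hF : Emits (d + 1) F) :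
    Emits d fun e => F (Function.update e d (g e)) := by
  obtain ⟨p, P, hp⟩ := hg.store hd
  obtain ⟨q, R, hq⟩ := hF
  refine ⟨.seq p (.seq q (.while d (some true) (.pop d))),
    -- With the new register occupied, all contents are bounded by `M + P.eval M`; this is where the
    -- length bound in `Emits` is needed.
    3 * P + R.comp (Polynomial.X + P) + 1, fun M e out hM he => ?_⟩
  obtain ⟨hl, t, ht, hr⟩ := hp M e out hM he
  have hed := he d le_rfl
  obtain ⟨hl', t', ht', hr'⟩ := hq (M + P.eval M) (Function.update e d (g e)) out
    (fun i => by
      have := hM i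
      simp only [Function.update_apply]; split_ifs <;> omega)
    (fun i hi => by rw [Function.update_of_ne (by omega)]; exact he i (by omega))
  obtain ⟨t'', ht'', hr''⟩ := run_clear (F (Function.update e d (g e)) ++ out) e
    (by omega : d ≠ 1) hed (g e)
  refine ⟨by simp; omega, t + (t' + t''), by simp; omega, .seq hr (.seq hr' hr'')⟩

/-- Register `d` is both bound and loop variable. It is decremented before the body, which therefore
sees `g e - 1, …, 0`; as output is built from the back, the pieces appear in increasing order, and
the register ends empty. -/
theorem Emits.flatMap_range {d : ℕ} (hd : 2 ≤ d) {g : (ℕ → ℕ) → ℕ} {F : (ℕ → ℕ) → List Bool}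
    (hg : Emits d fun e => List.replicate (g e) true) (hF : Emits (d + 1) F) :
    Emits d fun e => (List.range (g e)).flatMap fun x => F (Function.update e d x) := by
  obtain ⟨p, P, hp⟩ := hg.store hd
  obtain ⟨q, R, hq⟩ := hF
  refine ⟨.seq p (.while d (some true) (.seq (.pop d) q)),
    P + P * (R.comp (Polynomial.X + P) + 2) + 1, fun M e out hM he => ?_⟩
  obtain ⟨hl, t, ht, hr⟩ := hp M e out hM he
  have hed := he d le_rfl
  have hd1 : d ≠ 1 := by omega
  have hbody : ∀ x < g e, ∀ out, (F (Function.update e d x)).length ≤ R.eval (M + P.eval M) ∧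
      ∃ t ≤ R.eval (M + P.eval M), Run q (unaryStore out (Function.update e d x))
        (unaryStore (F (Function.update e d x) ++ out) (Function.update e d x)) t :=
    fun x hx out => hq (M + P.eval M) (Function.update e d x) out
      (fun i => by
        have := hM i
        simp only [Function.update_apply]; split_ifs <;> omega)
      (fun i hi => by rw [Function.update_of_ne (by omega)]; exact he i (by omega))
  obtain ⟨t', ht', hr'⟩ := run_while d (some true) (.seq (.pop d) q)
    (fun x => unaryStore
      (((List.range (g e)).drop x).flatMap (fun x => F (Function.update e d x)) ++ out)
      (Function.update e d x)) (R.eval (M + P.eval M) + 1) (g e)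
    (by simp [head?_register _ _ hd1])
    (fun x hx => ⟨by simp [head?_register _ _ hd1], by
      obtain ⟨-, t, ht, hr⟩ := hbody x hx
        (((List.range (g e)).drop (x + 1)).flatMap (fun x => F (Function.update e d x)) ++ out)
      refine ⟨1 + t, by omega, .seq (s' := unaryStore
          (((List.range (g e)).drop (x + 1)).flatMap (fun x => F (Function.update e d x)) ++ out)
          (Function.update e d x)) ?_ ?_⟩
      · convert run_pop_register _ _ hd1 using 2; simp
      · have hdrop : (List.range (g e)).drop x = x :: (List.range (g e)).drop (x + 1) := by
          rw [List.drop_eq_getElem_cons (by simpa using hx), List.getElem_range]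
        rw [hdrop, List.flatMap_cons, List.append_assoc]
        exact hr⟩)
  have e1 : Function.update e d 0 = e := by rw [← hed, Function.update_eq_self]
  have e2 : (List.range (g e)).drop (g e) = [] := by simp
  simp only [e1, e2, List.drop_zero, List.flatMap_nil, List.nil_append] at hr'
  have hlen : ∀ l : List ℕ, (∀ x ∈ l, x < g e) →
      (l.flatMap fun x => F (Function.update e d x)).length
        ≤ l.length * R.eval (M + P.eval M) := by
    intro l hl
    induction l with
    | nil => simp
    | cons a l ih =>
      have h1 := ih fun x hx => hl x (by simp [hx])
      have h2 := (hbody a (hl a (by simp)) []).1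
      simp only [List.flatMap_cons, List.length_append, List.length_cons, Nat.succ_mul]
      omega
  have hlen' := hlen (List.range (g e)) fun x hx => by simpa using hx
  have hm := Nat.mul_le_mul_right (R.eval (M + P.eval M) + 2) hl
  simp only [List.length_range] at hlen'
  simp only [Polynomial.eval_add, Polynomial.eval_mul, Polynomial.eval_comp, Polynomial.eval_X,
    Polynomial.eval_one, Polynomial.eval_ofNat]
  refine ⟨?_, t + t', ?_, .seq hr hr'⟩
  · rw [mul_add] at hm
    omega
  · have : R.eval (M + P.eval M) + 1 + 1 = R.eval (M + P.eval M) + 2 := rfl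
    rw [this] at ht'
    omega

theorem Emits.ite {d : ℕ} (hd : 2 ≤ d) {g : (ℕ → ℕ) → ℕ} {F G : (ℕ → ℕ) → List Bool}
    (hg : Emits d fun e => List.replicate (g e) true) (hF : Emits d F) (hG : Emits d G) :
    Emits d fun e => if g e = 0 then F e else G e := by
  obtain ⟨p, P, hp⟩ := hg.store hd
  obtain ⟨q, R, hq⟩ := hF
  obtain ⟨q', R', hq'⟩ := hG
  refine ⟨.seq p (.ite d (some true) (.seq (.while d (some true) (.pop d)) q') q),
    3 * P + R + R' + 2, fun M e out hM he => ?_⟩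
  obtain ⟨hl, t, ht, hr⟩ := hp M e out hM he
  have hed := he d le_rfl
  have hd1 : d ≠ 1 := by omega
  by_cases h0 : g e = 0
  · obtain ⟨hl', t', ht', hr'⟩ := hq M e out hM he
    have e1 : Function.update e d (g e) = e := by rw [h0, ← hed, Function.update_eq_self]
    rw [e1] at hr
    simp only [h0, if_true]
    refine ⟨by simp; omega, t + (t' + 1), by simp; omega,
      .seq hr (.ite_neg (by simp [head?_register _ _ hd1, hed]) hr')⟩
  · obtain ⟨hl', t', ht', hr'⟩ := hq' M e out hM he
    obtain ⟨t'', ht'', hr''⟩ := run_clear out e hd1 hed (g e)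
    simp only [h0, if_false]
    refine ⟨by simp; omega, t + (t'' + t' + 1), by simp; omega,
      .seq hr (.ite_pos (by simp [head?_register _ _ hd1, h0]) (.seq hr'' hr'))⟩

/-- Popping an empty stack does nothing, which is exactly truncated subtraction. Since `h` is
evaluated while register `d` holds the first number, it must not depend on that register. -/
theorem Emits.sub {d : ℕ} (hd : 2 ≤ d) {g h : (ℕ → ℕ) → ℕ}
    (hg : Emits d fun e => List.replicate (g e) true)
    (hh : Emits (d + 1) fun e => List.replicate (h e) true)
    (hi : ∀ e x, h (Function.update e d x) = h e) :
    Emits d fun e => List.replicate (g e - h e) true := by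
  obtain ⟨p, P, hp⟩ := hg.store hd
  obtain ⟨q, R, hq⟩ := hh.store (by omega)
  refine ⟨.seq p (.seq q (.seq
    (.while (d + 1) (some true) (.seq (.pop (d + 1)) (.pop d)))
    (.while d (some true) (.seq (.pop d) (.push 1 true))))),
    4 * P + 4 * R.comp (Polynomial.X + P) + 2, fun M e out hM he => ?_⟩
  obtain ⟨hl, t, ht, hr⟩ := hp M e out hM he
  have hd1 : d ≠ 1 := by omega
  have hd1' : d + 1 ≠ 1 := by omega
  have hed := he d le_rfl
  have hed' := he (d + 1) (by omega)
  obtain ⟨hl', t', ht', hr'⟩ := hq (M + P.eval M) (Function.update e d (g e)) out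
    (fun i => by
      have := hM i
      simp only [Function.update_apply]; split_ifs <;> omega)
    (fun i hi => by rw [Function.update_of_ne (by omega)]; exact he i (by omega))
  rw [hi] at hl' hr'
  obtain ⟨t₁, ht₁, hr₁⟩ := run_while (d + 1) (some true) (.seq (.pop (d + 1)) (.pop d))
    (fun x => unaryStore out
      (Function.update (Function.update e d (g e - (h e - x))) (d + 1) x)) 2 (h e)
    (by simp [head?_register _ _ hd1'])
    (fun x hx => ⟨by simp [head?_register _ _ hd1'], 2, le_rfl, by
      refine .seq (t := 1) (t' := 1) (run_pop_register _ _ hd1') ?_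
      convert run_pop_register _ _ hd1 using 2
      funext i
      simp only [Function.update_apply]
      split_ifs <;> omega⟩)
  obtain ⟨t₂, ht₂, hr₂⟩ := run_while d (some true) (.seq (.pop d) (.push 1 true))
    (fun x => unaryStore (List.replicate (g e - h e - x) true ++ out)
      (Function.update e d x)) 2 (g e - h e)
    (by simp [head?_register _ _ hd1])
    (fun x hx => ⟨by simp [head?_register _ _ hd1], 2, le_rfl, by
      refine .seq (t := 1) (t' := 1) (run_pop_register _ _ hd1) ?_
      convert run_push_output true _ _ using 2
      · rw [← List.cons_append, ← List.replicate_succ]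
        congr 2; omega
      · simp⟩)
  have e1 : Function.update (Function.update e d (g e - h e)) (d + 1) 0
      = Function.update e d (g e - h e) := by
    rw [Function.update_eq_self_iff, Function.update_of_ne (by omega), hed']
  have e2 : Function.update e d 0 = e := by rw [← hed, Function.update_eq_self]
  simp only [Nat.sub_self, Nat.sub_zero, List.replicate_zero, List.nil_append, e1, e2]
    at hr₁ hr₂
  refine ⟨by simp; omega, t + (t' + (t₁ + t₂)), by simp; omega,
    .seq hr (.seq hr' (.seq hr₁ hr₂))⟩

/-! ### Emission of numerical expressions in unary -/

/-- `g` depends on the registers below `d` only, and can be emitted in unary. -/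
structure EmitsNat (d : ℕ) (g : (ℕ → ℕ) → ℕ) : Prop where
  update : ∀ e i x, d ≤ i → g (Function.update e i x) = g e
  emits : ∀ d', d ≤ d' → 2 ≤ d' → Emits d' fun e => List.replicate (g e) true

theorem EmitsNat.mono {d d' : ℕ} {g : (ℕ → ℕ) → ℕ} (hg : EmitsNat d g) (h : d ≤ d') :
    EmitsNat d' g :=
  ⟨fun e i x hi => hg.update e i x (h.trans hi), fun c hc => hg.emits c (h.trans hc)⟩

theorem EmitsNat.var {d i : ℕ} (hi : i < d) (hi1 : i ≠ 1) : EmitsNat d fun e => e i :=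
  ⟨fun e j x hj => Function.update_of_ne (by omega) _ _,
    fun d' hd hd2 => .var hd2 (by omega) hi1⟩

theorem EmitsNat.const (d c : ℕ) : EmitsNat d fun _ => c :=
  ⟨fun _ _ _ _ => rfl, fun d' _ _ => .const d' _⟩

theorem EmitsNat.add {d : ℕ} {g h : (ℕ → ℕ) → ℕ} (hg : EmitsNat d g) (hh : EmitsNat d h) :
    EmitsNat d fun e => g e + h e := by
  refine ⟨fun e i x hi => by rw [hg.update e i x hi, hh.update e i x hi], fun d' hd hd2 => ?_⟩
  simpa only [List.replicate_add] using (hg.emits d' hd hd2).append (hh.emits d' hd hd2)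

theorem EmitsNat.sub {d : ℕ} {g h : (ℕ → ℕ) → ℕ} (hg : EmitsNat d g) (hh : EmitsNat d h) :
    EmitsNat d fun e => g e - h e :=
  ⟨fun e i x hi => by rw [hg.update e i x hi, hh.update e i x hi], fun d' hd hd2 =>
    (hg.emits d' hd hd2).sub hd2 (hh.emits (d' + 1) (by omega) (by omega))
      fun e x => hh.update e d' x hd⟩

theorem flatMap_replicate {α : Type} (l : List α) (c : ℕ) (b : Bool) :
    (l.flatMap fun _ => List.replicate c b) = List.replicate (l.length * c) b := by
  induction l with
  | nil => simp
  | cons a l ih =>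
    rw [List.flatMap_cons, ih, List.length_cons, Nat.succ_mul, add_comm, List.replicate_add]

theorem EmitsNat.mul {d : ℕ} {g h : (ℕ → ℕ) → ℕ} (hg : EmitsNat d g) (hh : EmitsNat d h) :
    EmitsNat d fun e => g e * h e := by
  refine ⟨fun e i x hi => by rw [hg.update e i x hi, hh.update e i x hi], fun d' hd hd2 => ?_⟩
  have := (hg.emits d' hd hd2).flatMap_range hd2 (hh.emits (d' + 1) (by omega) (by omega))
  simpa only [hh.update _ _ _ hd, flatMap_replicate, List.length_range] using this

theorem EmitsNat.pow {d : ℕ} {g : (ℕ → ℕ) → ℕ} (hg : EmitsNat d g) (c : ℕ) :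
    EmitsNat d fun e => g e ^ c := by
  induction c with
  | zero => simpa using EmitsNat.const d 1
  | succ c ih => simpa only [pow_succ] using ih.mul hg

theorem flatMap_ite_singleton {α : Type} (l : List α) (p : α → Prop) [DecidablePred p] (b : Bool) :
    (l.flatMap fun x => if p x then [b] else []) = List.replicate (l.countP p) b := by
  induction l with
  | nil => simp
  | cons a l ih =>
    rw [List.flatMap_cons, ih, List.countP_cons]
    by_cases h : p a
    · simp [h, List.replicate_succ]
    · simp [h]

theorem countP_range_of_lt_iff {p : ℕ → Prop} [DecidablePred p] {n c : ℕ} (hc : c ≤ n)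
    (h : ∀ x < n, p x ↔ x < c) : (List.range n).countP p = c := by
  obtain ⟨r, rfl⟩ := Nat.exists_eq_add_of_le hc
  rw [List.range_add, List.countP_append, List.countP_eq_length.2, List.length_range,
    List.countP_eq_zero.2, add_zero]
  · intro x hx
    obtain ⟨y, hy, rfl⟩ := List.mem_map.1 hx
    have := h (c + y) (by simpa using hy)
    simp [this]
  · intro x hx
    have hx' : x < c := by simpa using hx
    simpa using (h x (by omega)).2 hx'

/-- The quotient is the number of `x < g e` with `(x + 1) * h e ≤ g e`; comparisons are tested by
the vanishing of a truncated difference. -/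
theorem EmitsNat.div {d : ℕ} {g h : (ℕ → ℕ) → ℕ} (hg : EmitsNat d g) (hh : EmitsNat d h)
    (hpos : ∀ e, 0 < h e) : EmitsNat d fun e => g e / h e := by
  refine ⟨fun e i x hi => by rw [hg.update e i x hi, hh.update e i x hi], fun d' hd hd2 => ?_⟩
  have hx : EmitsNat (d' + 1) fun e => e d' := .var (by omega) (by omega)
  have hc := ((hx.add (.const _ 1)).mul (hh.mono (by omega))).sub (hg.mono (by omega))
  have := (hg.emits d' hd hd2).flatMap_range hd2 (Emits.ite (by omega)
    (hc.emits _ le_rfl (by omega)) (Emits.singleton _ true) (Emits.nil _))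
  refine (congrArg (Emits d') (funext fun e => ?_)).mp this
  simp only [hh.update _ _ _ hd, hg.update _ _ _ hd, Function.update_self,
    Nat.sub_eq_zero_iff_le]
  rw [flatMap_ite_singleton, countP_range_of_lt_iff (Nat.div_le_self _ _)]
  intro x _
  rw [← Nat.le_div_iff_mul_le (hpos e)]
  rfl

theorem EmitsNat.mod {d : ℕ} {g h : (ℕ → ℕ) → ℕ} (hg : EmitsNat d g) (hh : EmitsNat d h)
    (hpos : ∀ e, 0 < h e) : EmitsNat d fun e => g e % h e := by
  simpa only [Nat.mod_eq_sub] using hg.sub (hh.mul (hg.div hh hpos))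

/-! ### Grid points indexed by natural numbers -/

/-- The grid point whose coordinates are the digits of `N` in base `s + 1`. -/
def digitPoint (k s N : ℕ) : Grid k := fun i => ((N / (s + 1) ^ (i : ℕ) % (s + 1) : ℕ) : ℤ)

theorem digitPoint_injOn (k s : ℕ) :
    Set.InjOn (digitPoint k s) {N | N < (s + 1) ^ k} := by
  intro M hM N hN h
  have h' : finFunctionFinEquiv.symm (⟨M, hM⟩ : Fin ((s + 1) ^ k)) =
      finFunctionFinEquiv.symm ⟨N, hN⟩ := by
    funext i
    have := congrFun h i
    simp only [digitPoint, Nat.cast_inj] at this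
    ext
    simpa [finFunctionFinEquiv] using this
  simpa using congrArg Fin.val (finFunctionFinEquiv.symm.injective h')

/-- Digit `j` goes from `t` to `t + 1` without a carry because `t < s`; lower digits are unaffected,
and higher ones are zero on both sides. -/
theorem digitPoint_neighbors {k s j t r : ℕ} (hj : j < k) (ht : t < s) (hr : r < (s + 1) ^ j) :
    Neighbors (digitPoint k s (t * (s + 1) ^ j + r))
      (digitPoint k s (t * (s + 1) ^ j + r + (s + 1) ^ j)) := by
  unfold Neighbors
  rw [Finset.sum_eq_single (⟨j, hj⟩ : Fin k)]
  · have hpos : 0 < (s + 1) ^ j := by positivity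
    have h1 : (t * (s + 1) ^ j + r) / (s + 1) ^ j = t := by
      rw [mul_comm, Nat.mul_add_div hpos, Nat.div_eq_of_lt hr, add_zero]
    simp only [digitPoint]
    rw [Nat.add_div_right _ hpos, h1, Nat.mod_eq_of_lt (by omega : t < s + 1),
      Nat.mod_eq_of_lt (by omega : t.succ < s + 1)]
    simp
  · rintro ⟨i, hi⟩ - hne
    have hne' : i ≠ j := fun h => hne (by simp [h])
    simp only [digitPoint, abs_eq_zero, sub_eq_zero, Nat.cast_inj]
    rcases Nat.lt_or_gt_of_ne hne' with h | h
    · obtain ⟨d, rfl⟩ := Nat.exists_eq_add_of_lt h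
      have e : (s + 1) ^ (i + d + 1) = (s + 1) ^ i * ((s + 1) ^ d * (s + 1)) := by ring
      rw [e, Nat.add_mul_div_left _ _ (by positivity), Nat.add_mul_mod_self_right]
    · have hle : (s + 1) ^ (j + 1) ≤ (s + 1) ^ i := Nat.pow_le_pow_right (by omega) h
      have hlt : t * (s + 1) ^ j + r + (s + 1) ^ j < (s + 1) ^ (j + 1) := by
        have := Nat.mul_le_mul_right ((s + 1) ^ j) (by omega : t + 2 ≤ s + 1)
        rw [pow_succ, mul_comm _ (s + 1)]
        nlinarith
      rw [Nat.div_eq_of_lt (by omega), Nat.div_eq_of_lt (by omega)]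
  · simp

/-! ### The tree of controlled nots

The parent of `N` is obtained by decreasing the leading digit. -/

/-- The edges to the nodes `N ≤ n` whose leading digit is `t + 1`, in position `j`, and whose
parents are at least `b`. -/
def treeEdges (n s b j t : ℕ) : List (ℕ × ℕ) :=
  (((List.range ((s + 1) ^ j)).map fun r => t * (s + 1) ^ j + r).filter
    fun u => b ≤ u ∧ u + (s + 1) ^ j ≤ n).map fun u => (u, u + (s + 1) ^ j)

/-- All edges of the tree, from the root to the leaves, in layers. -/
def treeLayers (n s k b : ℕ) : List (List (ℕ × ℕ)) :=
  (List.range k).flatMap fun j => (List.range s).map fun t => treeEdges n s b j t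

theorem mem_treeEdges {n s b j t : ℕ} {e : ℕ × ℕ} :
    e ∈ treeEdges n s b j t ↔ ∃ r < (s + 1) ^ j, e.1 = t * (s + 1) ^ j + r ∧
      e.2 = e.1 + (s + 1) ^ j ∧ b ≤ e.1 ∧ e.2 ≤ n := by
  obtain ⟨u, v⟩ := e
  simp only [treeEdges, List.mem_map, List.mem_filter, List.mem_range, Prod.mk.injEq,
    decide_eq_true_eq]
  constructor
  · rintro ⟨u, ⟨⟨r, hr, rfl⟩, h⟩, rfl, rfl⟩
    exact ⟨r, hr, rfl, rfl, h⟩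
  · rintro ⟨r, hr, rfl, rfl, h⟩
    exact ⟨_, ⟨⟨r, hr, rfl⟩, h⟩, rfl, rfl⟩

theorem mem_treeLayers {n s k b : ℕ} {S : List (ℕ × ℕ)} :
    S ∈ treeLayers n s k b ↔ ∃ j < k, ∃ t < s, treeEdges n s b j t = S := by
  simp [treeLayers]

/-- The last two bounds put the children of a layer in an interval; over the layers these intervals
follow each other in increasing order, which gives `treeLayers_pairwise`. -/
theorem treeEdges_bounds {n s b j t : ℕ} {e : ℕ × ℕ} (h : e ∈ treeEdges n s b j t) :
    b ≤ e.1 ∧ e.1 < e.2 ∧ e.2 ≤ n ∧ (t + 1) * (s + 1) ^ j ≤ e.2 ∧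
      e.2 < (t + 2) * (s + 1) ^ j := by
  obtain ⟨r, hr, h1, h2, h3, h4⟩ := mem_treeEdges.1 h
  have : 0 < (s + 1) ^ j := by positivity
  refine ⟨h3, by omega, h4, ?_, ?_⟩
  · rw [Nat.succ_mul]; omega
  · rw [Nat.succ_mul, Nat.succ_mul]; omega

theorem treeEdges_pairwise (n s b j t : ℕ) :
    (treeEdges n s b j t).Pairwise fun e f =>
      e.2 < f.2 ∧ e.1 ≠ f.1 ∧ e.1 ≠ f.2 ∧ e.2 ≠ f.1 := by
  unfold treeEdges
  rw [List.pairwise_map]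
  refine List.Pairwise.filter _ ?_
  rw [List.pairwise_map]
  refine (List.pairwise_lt_range (n := (s + 1) ^ j)).imp_of_mem fun {x y} hx hy hxy => ?_
  simp only [List.mem_range] at hx hy
  dsimp only
  omega

theorem treeLayers_pairwise (n s k b : ℕ) :
    (treeLayers n s k b).Pairwise fun S T => ∀ e ∈ S, ∀ f ∈ T, e.2 < f.2 := by
  unfold treeLayers
  rw [List.pairwise_flatMap]
  refine ⟨fun j _ => ?_, ?_⟩
  · rw [List.pairwise_map]
    refine List.pairwise_lt_range.imp fun {t u} htu e he f hf => ?_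
    have h1 := treeEdges_bounds he
    have h2 := treeEdges_bounds hf
    have := Nat.mul_le_mul_right ((s + 1) ^ j) (by omega : t + 2 ≤ u + 1)
    omega
  · refine List.pairwise_lt_range.imp fun {i j} hij S hS T hT e he f hf => ?_
    obtain ⟨t, ht, rfl⟩ := List.mem_map.1 hS
    obtain ⟨u, hu, rfl⟩ := List.mem_map.1 hT
    have h1 := treeEdges_bounds he
    have h2 := treeEdges_bounds hf
    have ht' : t < s := by simpa using ht
    have h3 := Nat.mul_le_mul_right ((s + 1) ^ i) (by omega : t + 2 ≤ s + 1)
    have h4 : (s + 1) ^ (i + 1) ≤ (s + 1) ^ j := Nat.pow_le_pow_right (by omega) hij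
    have h5 := Nat.mul_le_mul_right ((s + 1) ^ j) (by omega : 1 ≤ u + 1)
    rw [pow_succ, mul_comm] at h4
    omega

theorem treeLayers_flatten_bounds {n s k b : ℕ} {e : ℕ × ℕ}
    (h : e ∈ (treeLayers n s k b).flatten) : b ≤ e.1 ∧ e.1 < e.2 ∧ e.2 ≤ n := by
  obtain ⟨S, hS, he⟩ := List.mem_flatten.1 h
  obtain ⟨j, -, t, -, rfl⟩ := mem_treeLayers.1 hS
  have := treeEdges_bounds he
  omega

theorem treeLayers_flatten_pairwise (n s k b : ℕ) :
    (treeLayers n s k b).flatten.Pairwise fun e f => e.2 < f.2 := by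
  rw [List.pairwise_flatten]
  refine ⟨fun S hS => ?_, treeLayers_pairwise n s k b⟩
  obtain ⟨j, -, t, -, rfl⟩ := mem_treeLayers.1 hS
  exact (treeEdges_pairwise n s b j t).imp fun h => h.1

theorem treeLayers_flatten_nodup (n s k b : ℕ) :
    ((treeLayers n s k b).flatten.map Prod.snd).Nodup := by
  rw [List.Nodup, List.pairwise_map]
  exact (treeLayers_flatten_pairwise n s k b).imp fun h => h.ne

theorem treeLayers_flatten_parent_unique {n s k b : ℕ} {e f : ℕ × ℕ}
    (he : e ∈ (treeLayers n s k b).flatten) (hf : f ∈ (treeLayers n s k b).flatten)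
    (h : e.2 = f.2) : e.1 = f.1 := by
  rw [List.inj_on_of_nodup_map (treeLayers_flatten_nodup n s k b) he hf h]

theorem mem_treeLayers_flatten_of_le {n s k b c : ℕ} (hbc : b ≤ c) {e : ℕ × ℕ}
    (he : e ∈ (treeLayers n s k c).flatten) : e ∈ (treeLayers n s k b).flatten := by
  obtain ⟨S, hS, he⟩ := List.mem_flatten.1 he
  obtain ⟨j, hj, t, ht, rfl⟩ := mem_treeLayers.1 hS
  obtain ⟨r, hr, h1, h2, h3, h4⟩ := mem_treeEdges.1 he
  exact List.mem_flatten.2 ⟨_, mem_treeLayers.2 ⟨j, hj, t, ht, rfl⟩,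
    mem_treeEdges.2 ⟨r, hr, h1, h2, hbc.trans h3, h4⟩⟩

/-- Only the order of the layers is reversed, not that inside a layer, where disjointness of the
edges suffices. -/
theorem treeLayers_reverse_flatten_pairwise (n s k b : ℕ) :
    (treeLayers n s k b).reverse.flatten.Pairwise fun e f => e.2 ≠ f.2 ∧ f.1 ≠ e.2 := by
  rw [List.pairwise_flatten]
  refine ⟨fun S hS => ?_, ?_⟩
  · obtain ⟨j, -, t, -, rfl⟩ := mem_treeLayers.1 (List.mem_reverse.1 hS)
    exact (treeEdges_pairwise n s b j t).imp fun h => by omega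
  · rw [List.pairwise_reverse]
    refine (treeLayers_pairwise n s k b).imp_of_mem fun {S T} hS hT h e he f hf => ?_
    have h1 := h f hf e he
    have h2 := treeLayers_flatten_bounds (List.mem_flatten.2 ⟨S, hS, hf⟩)
    omega

/-- Induction on the number of digits, down to the position of the leading one. The parent does not
depend on the cutoff `b`, so one choice serves both passes. -/
theorem exists_mem_treeLayers_flatten {n s k N : ℕ} (h1 : 1 ≤ N) (hn : N ≤ n)
    (hk : N < (s + 1) ^ k) :
    ∃ u < N, ∀ b ≤ u, (u, N) ∈ (treeLayers n s k b).flatten := by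
  induction k with
  | zero => simp at hk; omega
  | succ k ih =>
    by_cases hN : N < (s + 1) ^ k
    · obtain ⟨u, hu, h⟩ := ih hN
      refine ⟨u, hu, fun b hb => ?_⟩
      rw [treeLayers, List.range_succ, List.flatMap_append, List.flatten_append]
      exact List.mem_append_left _ (h b hb)
    · have hpos : 0 < (s + 1) ^ k := by positivity
      have hq1 : 1 ≤ N / (s + 1) ^ k := (Nat.one_le_div_iff hpos).2 (by omega)
      have hq2 : N / (s + 1) ^ k < s + 1 := by
        rw [Nat.div_lt_iff_lt_mul hpos]; rwa [pow_succ, mul_comm] at hk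
      have hdiv := Nat.div_add_mod N ((s + 1) ^ k)
      have hmod := Nat.mod_lt N hpos
      refine ⟨N - (s + 1) ^ k, by omega, fun b hb => List.mem_flatten.2
        ⟨_, mem_treeLayers.2 ⟨k, by omega, N / (s + 1) ^ k - 1, by omega, rfl⟩,
          mem_treeEdges.2 ⟨N % (s + 1) ^ k, hmod, ?_, by dsimp only; omega, hb, hn⟩⟩⟩
      dsimp only
      rw [Nat.sub_mul, mul_comm _ ((s + 1) ^ k), one_mul]
      have := Nat.mul_le_mul_left ((s + 1) ^ k) hq1
      omega

theorem length_treeLayers_flatten_le (n s k b : ℕ) :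
    (treeLayers n s k b).flatten.length ≤ n := by
  have h := treeLayers_flatten_nodup n s k b
  rw [← List.length_map (f := Prod.snd), ← List.toFinset_card_of_nodup h]
  refine (Finset.card_le_card fun N hN => ?_).trans_eq (Nat.card_Icc 1 n)
  simp only [List.mem_toFinset, List.mem_map] at hN
  obtain ⟨e, he, rfl⟩ := hN
  have := treeLayers_flatten_bounds he
  simp only [Finset.mem_Icc]
  omega

/-! ### Controlled nots along a tree, on bits -/

section Bits

variable {Q : Type} [DecidableEq Q]

theorem foldr_cnot_apply_of_notMem {l : List (Q × Q)} {q : Q} (h : ∀ e ∈ l, e.2 ≠ q)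
    (x : Config Q) : l.foldr (fun e x => cnot e.1 e.2 x) x q = x q := by
  induction l with
  | nil => rfl
  | cons e l ih =>
    rw [List.foldr_cons, cnot, Function.update_of_ne (h e (by simp)).symm]
    exact ih fun f hf => h f (by simp [hf])

/-- Controlled nots applied from the root to the leaves. -/
theorem foldr_cnot_rootFirst {l : List (Q × Q)} (hne : ∀ e ∈ l, e.1 ≠ e.2)
    (h : l.Pairwise fun e f => e.2 ≠ f.2 ∧ f.1 ≠ e.2) (x : Config Q) :
    ∀ e ∈ l, l.foldr (fun e x => cnot e.1 e.2 x) x e.2 =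
      xor (x e.2) (l.foldr (fun e x => cnot e.1 e.2 x) x e.1) := by
  induction l with
  | nil => simp
  | cons e l ih =>
    rw [List.pairwise_cons] at h
    intro f hf
    rw [List.foldr_cons]
    rcases List.mem_cons.1 hf with rfl | hf
    · rw [cnot, Function.update_self, Function.update_of_ne (hne f (by simp)),
        foldr_cnot_apply_of_notMem fun g hg => (h.1 g hg).1.symm]
    · rw [cnot, Function.update_of_ne (h.1 f hf).1.symm, Function.update_of_ne (h.1 f hf).2]
      exact ih (fun g hg => hne g (by simp [hg])) h.2 f hf

/-- Controlled nots applied from the leaves to the root. -/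
theorem foldr_cnot_leavesFirst {l : List (Q × Q)} (hne : ∀ e ∈ l, e.1 ≠ e.2)
    (h : l.Pairwise fun e f => e.2 ≠ f.2 ∧ e.1 ≠ f.2) (x : Config Q) :
    ∀ e ∈ l, l.foldr (fun e x => cnot e.1 e.2 x) x e.2 = xor (x e.2) (x e.1) := by
  induction l with
  | nil => simp
  | cons e l ih =>
    rw [List.pairwise_cons] at h
    intro f hf
    rw [List.foldr_cons]
    rcases List.mem_cons.1 hf with rfl | hf
    · rw [cnot, Function.update_self, foldr_cnot_apply_of_notMem fun g hg => (h.1 g hg).1.symm,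
        foldr_cnot_apply_of_notMem fun g hg => (h.1 g hg).2.symm]
    · rw [cnot, Function.update_of_ne (h.1 f hf).1.symm]
      exact ih (fun g hg => hne g (by simp [hg])) h.2 f hf

end Bits

/-! ### The fanout circuit -/

/-- The layers of controlled nots: towards the root, all edges; then away from the root, the edges
that are not at the root. -/
def fanoutLayers (k n s : ℕ) : List (List (Grid k × Grid k)) :=
  ((treeLayers n s k 0).reverse ++ treeLayers n s k 1).map fun S =>
    S.map (Prod.map (digitPoint k s) (digitPoint k s))

theorem mem_fanoutLayers {k n s : ℕ} {S : List (Grid k × Grid k)} (h : S ∈ fanoutLayers k n s) :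
    ∃ b, ∃ j < k, ∃ t < s,
      (treeEdges n s b j t).map (Prod.map (digitPoint k s) (digitPoint k s)) = S := by
  simp only [fanoutLayers, List.mem_map, List.mem_append, List.mem_reverse, mem_treeLayers] at h
  obtain ⟨T, ⟨j, hj, t, ht, rfl⟩ | ⟨j, hj, t, ht, rfl⟩, rfl⟩ := h
  · exact ⟨0, j, hj, t, ht, rfl⟩
  · exact ⟨1, j, hj, t, ht, rfl⟩

theorem fanoutLayers_neighbors {k n s : ℕ} {S : List (Grid k × Grid k)}
    (h : S ∈ fanoutLayers k n s) : ∀ e ∈ S, Neighbors e.1 e.2 := by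
  obtain ⟨b, j, hj, t, ht, rfl⟩ := mem_fanoutLayers h
  intro e he
  obtain ⟨f, hf, rfl⟩ := List.mem_map.1 he
  obtain ⟨r, hr, h1, h2, -⟩ := mem_treeEdges.1 hf
  simp only [Prod.map_fst, Prod.map_snd, h2, h1]
  exact digitPoint_neighbors hj ht hr

theorem fanoutLayers_disjoint {k n s : ℕ} (hn : n < (s + 1) ^ k) {S : List (Grid k × Grid k)}
    (h : S ∈ fanoutLayers k n s) : S.Pairwise DisjointPairs := by
  obtain ⟨b, j, hj, t, ht, rfl⟩ := mem_fanoutLayers h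
  rw [List.pairwise_map]
  refine (treeEdges_pairwise n s b j t).imp_of_mem fun {e f} he hf hef => ?_
  have h1 := treeEdges_bounds he
  have h2 := treeEdges_bounds hf
  have inj : ∀ {M N : ℕ}, M ≤ n → N ≤ n → M ≠ N → digitPoint k s M ≠ digitPoint k s N :=
    fun hM hN hne he => hne (digitPoint_injOn k s (by simp; omega) (by simp; omega) he)
  exact ⟨inj (by omega) (by omega) hef.2.1, inj (by omega) (by omega) hef.2.2.1,
    inj (by omega) (by omega) hef.2.2.2, inj (by omega) (by omega) hef.1.ne⟩

/-- On labels the circuit acts backwards in time: `z` is the result of the edges not at the root,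
now taken from the leaves, and `y` that of all edges, now taken from the root. The cancellation is
the same in this order, by strong induction on `N` through its parent. -/
theorem foldr_fanoutLayers {k n s : ℕ} (hn : n < (s + 1) ^ k) (x : Config (Grid k)) :
    (∀ q, (∀ N, 1 ≤ N → N ≤ n → digitPoint k s N ≠ q) →
      (fanoutLayers k n s).flatten.foldr (fun e x => cnot e.1 e.2 x) x q = x q) ∧
    ∀ N, 1 ≤ N → N ≤ n →
      (fanoutLayers k n s).flatten.foldr (fun e x => cnot e.1 e.2 x) x (digitPoint k s N) =
        xor (x (digitPoint k s N)) (x (digitPoint k s 0)) := by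
  have inj : ∀ {M N : ℕ}, M ≤ n → N ≤ n → M ≠ N → digitPoint k s M ≠ digitPoint k s N :=
    fun hM hN hne he => hne (digitPoint_injOn k s (by simp; omega) (by simp; omega) he)
  set f := Prod.map (digitPoint k s) (digitPoint k s) with hf
  have hsplit : (fanoutLayers k n s).flatten =
      (treeLayers n s k 0).reverse.flatten.map f ++ (treeLayers n s k 1).flatten.map f := by
    rw [fanoutLayers, List.map_append, List.flatten_append, List.map_flatten, List.map_flatten]
  have hA : ∀ e ∈ (treeLayers n s k 0).reverse.flatten, e.1 < e.2 ∧ e.2 ≤ n := fun e he =>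
    (treeLayers_flatten_bounds (b := 0) (by simpa using he)).2
  have hB : ∀ e ∈ (treeLayers n s k 1).flatten, 1 ≤ e.1 ∧ e.1 < e.2 ∧ e.2 ≤ n := fun e he =>
    treeLayers_flatten_bounds he
  rw [hsplit, List.foldr_append]
  set z := ((treeLayers n s k 1).flatten.map f).foldr (fun e x => cnot e.1 e.2 x) x with hz
  have hzq : ∀ q, (∀ e ∈ (treeLayers n s k 1).flatten, digitPoint k s e.2 ≠ q) → z q = x q :=
    fun q hq => foldr_cnot_apply_of_notMem (fun e he => by
      obtain ⟨g, hg, rfl⟩ := List.mem_map.1 he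
      exact hq g hg) x
  have hze : ∀ e ∈ (treeLayers n s k 1).flatten, z (digitPoint k s e.2) =
      xor (x (digitPoint k s e.2)) (x (digitPoint k s e.1)) := fun e he =>
    foldr_cnot_leavesFirst
      (fun e he => by
        obtain ⟨g, hg, rfl⟩ := List.mem_map.1 he
        have := hB g hg
        exact inj (by omega) (by omega) (by omega))
      (by
        rw [List.pairwise_map]
        refine (treeLayers_flatten_pairwise n s k 1).imp_of_mem fun {e g} he hg h => ?_
        have h1 := hB e he
        have h2 := hB g hg
        exact ⟨inj (by omega) (by omega) (by omega), inj (by omega) (by omega) (by omega)⟩)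
      x (f e) (List.mem_map.2 ⟨e, he, rfl⟩)
  set y := ((treeLayers n s k 0).reverse.flatten.map f).foldr (fun e x => cnot e.1 e.2 x) z
    with hy
  have hyq : ∀ q, (∀ N, 1 ≤ N → N ≤ n → digitPoint k s N ≠ q) → y q = x q := fun q hq => by
    rw [hy, foldr_cnot_apply_of_notMem, hzq]
    · intro e he
      have := hB e he
      exact hq _ (by omega) (by omega)
    · intro e he
      obtain ⟨g, hg, rfl⟩ := List.mem_map.1 he
      have := hA g hg
      exact hq _ (by omega) (by omega)
  have hye : ∀ e ∈ (treeLayers n s k 0).reverse.flatten, y (digitPoint k s e.2) =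
      xor (z (digitPoint k s e.2)) (y (digitPoint k s e.1)) := fun e he =>
    foldr_cnot_rootFirst
      (fun e he => by
        obtain ⟨g, hg, rfl⟩ := List.mem_map.1 he
        have := hA g hg
        exact inj (by omega) (by omega) (by omega))
      (by
        rw [List.pairwise_map]
        refine (treeLayers_reverse_flatten_pairwise n s k 0).imp_of_mem fun {e g} he hg h => ?_
        have h1 := hA e he
        have h2 := hA g hg
        exact ⟨inj (by omega) (by omega) h.1, inj (by omega) (by omega) h.2⟩)
      z (f e) (List.mem_map.2 ⟨e, he, rfl⟩)
  refine ⟨hyq, fun N => ?_⟩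
  induction N using Nat.strong_induction_on with
  | _ N ih =>
    intro h1 hN
    obtain ⟨u, hu, hmem⟩ := exists_mem_treeLayers_flatten (s := s) (k := k) h1 hN (by omega)
    have h2 := hye (u, N) (by simpa using hmem 0 (by omega))
    rw [h2]
    rcases Nat.eq_zero_or_pos u with rfl | hu0
    · rw [hzq, hyq]
      · intro M hM hMn
        exact inj hMn (by omega) (by omega)
      · intro e he heq
        -- A child of the root has no other parent, so the pass without root edges cannot have
        -- changed it.
        have h3 := hB e he
        have h4 : e.2 = N := by
          by_contra h4
          exact inj (by omega) hN h4 heq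
        have h5 := treeLayers_flatten_parent_unique (mem_treeLayers_flatten_of_le (Nat.zero_le 1) he)
          (hmem 0 le_rfl) h4
        omega
    · rw [hze (u, N) (hmem 1 hu0), ih u hu hu0 (by omega)]
      simp

/-- The `k`-th root of `n`, rounded down, for `1 ≤ k`. -/
def floorRoot (k n : ℕ) : ℕ := (List.range n).countP fun x => (x + 1) ^ k ≤ n

/-- The first bound gives the depth, the second makes `0, …, n` fit into the cube. `floorRoot` is a
count so that a loop can print it; here it is compared with `Nat.findGreatest`. -/
theorem floorRoot_spec {k : ℕ} (hk : 1 ≤ k) (n : ℕ) :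
    floorRoot k n ^ k ≤ n ∧ n < (floorRoot k n + 1) ^ k := by
  have hle := Nat.findGreatest_le (P := fun x => x ^ k ≤ n) n
  have hspec : Nat.findGreatest (fun x => x ^ k ≤ n) n ^ k ≤ n :=
    Nat.findGreatest_spec (P := fun x => x ^ k ≤ n) (Nat.zero_le n)
      (by rw [zero_pow (by omega)]; exact Nat.zero_le n)
  have hgt : ∀ {x}, Nat.findGreatest (fun x => x ^ k ≤ n) n < x → x ≤ n → ¬ x ^ k ≤ n :=
    fun h h' => Nat.findGreatest_is_greatest (P := fun x => x ^ k ≤ n) h h'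
  have h : floorRoot k n = Nat.findGreatest (fun x => x ^ k ≤ n) n := by
    refine countP_range_of_lt_iff hle fun x hx => ⟨fun h => ?_, fun h => ?_⟩
    · by_contra h'
      exact hgt (by omega : _ < x + 1) (by omega) h
    · exact (Nat.pow_le_pow_left h k).trans hspec
  rw [h]
  refine ⟨hspec, ?_⟩
  by_contra h'
  have h1 := Nat.le_self_pow (by omega : k ≠ 0)
    (Nat.findGreatest (fun x => x ^ k ≤ n) n + 1)
  exact hgt (Nat.lt_succ_self _) (by omega) (not_lt.1 h')

/-! ### The circuit of basic operations: validity, resources and action on states. -/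

section Circuit

variable {k a b : ℕ}

/-- The fanout circuit, given a word for the controlled not. -/
def fanoutCircuit (k : ℕ) (w : List (Letter a b)) (n : ℕ) : Circuit k a b :=
  (fanoutLayers k n (floorRoot k n)).flatMap (wordLayers w)

theorem fanoutCircuit_isValid (hk : 1 ≤ k) (w : List (Letter a b)) (n : ℕ) :
    (fanoutCircuit k w n).IsValid := by
  intro S hS
  obtain ⟨T, hT, hS⟩ := List.mem_flatMap.1 hS
  obtain ⟨L, -, rfl⟩ := List.mem_map.1 hS
  refine ⟨?_, fun I hI => ?_⟩
  · rw [List.pairwise_map]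
    refine (fanoutLayers_disjoint (floorRoot_spec hk n).2 hT).imp fun {e f} hef => ?_
    obtain ⟨h1, h2, h3, h4⟩ := hef
    intro q hq hq'
    rcases L.qubits_instr_subset _ _ q hq with rfl | rfl <;>
      rcases L.qubits_instr_subset _ _ _ hq' with h | h <;> contradiction
  · obtain ⟨e, he, rfl⟩ := List.mem_map.1 hI
    exact L.isLocal_instr (fanoutLayers_neighbors hT e he)

theorem length_flatMap_wordLayers (w : List (Letter a b)) (l : List (List (Grid k × Grid k))) :
    (l.flatMap (wordLayers w)).length = l.length * w.length := by
  induction l with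
  | nil => simp
  | cons S l ih =>
    rw [List.flatMap_cons, List.length_append, ih, wordLayers, List.length_map, List.length_cons]
    ring

theorem depth_fanoutCircuit (w : List (Letter a b)) (n : ℕ) :
    (fanoutCircuit k w n).depth = 2 * k * floorRoot k n * w.length := by
  have h : ∀ b s, (treeLayers n s k b).length = k * s := fun b s => by
    simp [treeLayers, List.length_flatMap]
  rw [Circuit.depth, fanoutCircuit, length_flatMap_wordLayers, fanoutLayers, List.length_map,
    List.length_append, List.length_reverse, h, h]
  ring

theorem size_flatMap_wordLayers (w : List (Letter a b)) (l : List (List (Grid k × Grid k))) :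
    Circuit.size (l.flatMap (wordLayers w)) = l.flatten.length * w.length := by
  unfold Circuit.size
  induction l with
  | nil => simp
  | cons S l ih =>
    have h : ((wordLayers w S).map List.length).sum = S.length * w.length := by
      simp [wordLayers, Function.comp_def, mul_comm]
    rw [List.flatMap_cons, List.map_append, List.sum_append, ih, h, List.flatten_cons,
      List.length_append, add_mul]

theorem size_fanoutCircuit_le (w : List (Letter a b)) (n : ℕ) :
    (fanoutCircuit k w n).size ≤ 2 * w.length * n := by
  rw [fanoutCircuit, size_flatMap_wordLayers]
  have h0 := length_treeLayers_flatten_le n (floorRoot k n) k 0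
  have h1 := length_treeLayers_flatten_le n (floorRoot k n) k 1
  have h : (fanoutLayers k n (floorRoot k n)).flatten.length ≤ 2 * n := by
    rw [fanoutLayers, List.map_append, List.flatten_append, ← List.map_flatten,
      ← List.map_flatten, List.length_append, List.length_map, List.length_map]
    have h2 : (treeLayers n (floorRoot k n) k 0).reverse.flatten.length =
        (treeLayers n (floorRoot k n) k 0).flatten.length :=
      (List.reverse_perm _).flatten.length_eq
    omega
  calc _ ≤ 2 * n * w.length := Nat.mul_le_mul_right _ h
    _ = _ := by ring

theorem width_le_two_mul_size (C : Circuit k a b) : C.width ≤ 2 * C.size := by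
  have h : ∀ l : List (Instr k a b), (l.flatMap Instr.qubits).length ≤ 2 * l.length := by
    intro l
    induction l with
    | nil => simp
    | cons I l ih =>
      have : I.qubits.length ≤ 2 := by cases I <;> simp [Instr.qubits]
      rw [List.flatMap_cons, List.length_append, List.length_cons]
      omega
  refine (List.toFinset_card_le _).trans ((h _).trans_eq ?_)
  rw [Circuit.size, List.length_flatten]

/-- As `Φ` fixes every ancilla bit, the condition that all ancillas are `0` is invariant under it.
-/
theorem pullback_place {D : Type} (loc : D → Grid k) {Φ : Config (Grid k) → Config (Grid k)}
    {φ : Config D → Config D} (h : ∀ x q, q ∉ Set.range loc → Φ x q = x q)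
    (h' : ∀ x, Φ x ∘ loc = φ (x ∘ loc)) (σ : State D) :
    pullback Φ (place loc σ) = place loc (pullback φ σ) := by
  ext x y
  simp only [pullback_apply, place, Matrix.of_apply, h']
  have hiff : (∀ q, q ∉ Set.range loc → Φ x q = false ∧ Φ y q = false) ↔
      ∀ q, q ∉ Set.range loc → x q = false ∧ y q = false :=
    forall_congr' fun q => forall_congr' fun hq => by rw [h x q hq, h y q hq]
  by_cases hP : ∀ q, q ∉ Set.range loc → x q = false ∧ y q = false
  · rw [if_pos (hiff.2 hP), if_pos hP]
  · rw [if_neg fun h => hP (hiff.1 h), if_neg hP]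

theorem fanoutMap_involutive (n : ℕ) : Function.Involutive (fanoutMap n) := by
  intro x
  funext o
  cases o <;> simp [fanoutMap]

theorem fanout_eq_pullback (n : ℕ) : fanout n = pullback (fanoutMap n) :=
  conj_perm (fanoutMap_involutive n)

/-- The placement of the control and the targets. -/
def fanoutLocation (k n : ℕ) (o : Option (Fin n)) : Grid k :=
  digitPoint k (floorRoot k n) (o.elim 0 fun i => i + 1)

theorem fanoutLocation_injective (hk : 1 ≤ k) (n : ℕ) :
    Function.Injective (fanoutLocation k n) := by
  have hn := (floorRoot_spec hk n).2
  intro o o' h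
  have h1 := digitPoint_injOn k (floorRoot k n)
    (by rcases o with _ | i <;> simp; omega) (by rcases o' with _ | i <;> simp; omega) h
  rcases o with _ | i <;> rcases o' with _ | j <;> simp at h1 ⊢
  exact Fin.ext h1

theorem run_fanoutCircuit (hk : 1 ≤ k) {G₁ : Fin a → Superop (Fin 1)}
    {G₂ : Fin b → Superop (Fin 2)} {w : List (Letter a b)}
    (hw : (w.map fun L => MulOpposite.op (L.eval G₁ G₂)).prod =
      MulOpposite.op (pullback (cnot 0 1))) (n : ℕ) (σ : State (Option (Fin n))) :
    (fanoutCircuit k w n).run G₁ G₂ (place (fanoutLocation k n) σ) =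
      place (fanoutLocation k n) (fanout n σ) := by
  have hn := (floorRoot_spec hk n).2
  rw [fanoutCircuit, run_flatMap_wordLayers G₁ G₂ hw
    (fun S hS => fanoutLayers_disjoint hn hS)
    (fun S hS e he => (fanoutLayers_neighbors hS e he).ne), fanout_eq_pullback]
  refine pullback_place _ (fun x q hq => ?_) (fun x => ?_) σ
  · refine (foldr_fanoutLayers hn x).1 q fun N hN1 hN h => hq ⟨some ⟨N - 1, by omega⟩, ?_⟩
    simp only [fanoutLocation, Option.elim_some]
    rw [Nat.sub_add_cancel hN1, h]
  · funext o
    rcases o with _ | i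
    · refine (foldr_fanoutLayers hn x).1 _ fun N hN1 hN h => ?_
      have := digitPoint_injOn k (floorRoot k n) (by simp; omega) (by simp) h
      simp only [Option.elim_none] at this
      omega
    · exact (foldr_fanoutLayers hn x).2 _ (by simp) (by simp)

/-! ### Uniformity -/

theorem Emits.encodePoint_digitPoint {d : ℕ} (hd : 2 ≤ d) {σ ν : (ℕ → ℕ) → ℕ}
    (hσ : EmitsNat d σ) (hν : EmitsNat d ν) :
    Emits d fun e => encodePoint (digitPoint k (σ e) (ν e)) := by
  have h : ∀ s N, encodePoint (digitPoint k s N) = (List.finRange k).flatMap fun i : Fin k =>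
      [false] ++ (List.replicate (N / (s + 1) ^ (i : ℕ) % (s + 1)) true ++ [false]) := by
    intro s N
    rw [encodePoint, List.ofFn_eq_map, List.flatMap_map]
    refine congrArg (fun f => List.flatMap f _) (funext fun i => ?_)
    have h0 : ¬ ((N / (s + 1) ^ (i : ℕ) % (s + 1) : ℕ) : ℤ) < 0 := by omega
    simp only [encodeInt, digitPoint, Int.natAbs_natCast, encodeNat, List.singleton_append]
    exact congrArg (· :: _) (decide_eq_false h0)
  simp only [h]
  have hs : EmitsNat d fun e => σ e + 1 := hσ.add (.const _ 1)
  exact .flatMap_const _ fun i _ => (Emits.singleton _ _).append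
    (((hν.div (hs.pow _) fun e => by positivity).mod hs fun e => by positivity).emits d le_rfl hd
      |>.append (.singleton _ _))

theorem Emits.encodeInstr_instr {d : ℕ} (L : Letter a b) {P Q : (ℕ → ℕ) → Grid k}
    (hP : Emits d fun e => encodePoint (P e)) (hQ : Emits d fun e => encodePoint (Q e)) :
    Emits d fun e => encodeInstr (L.instr (P e) (Q e)) := by
  have hc := fun l => Emits.const d l
  match L with
  | .inl (g, true) => exact (hc [false]).append ((hc (encodeNat g)).append hQ)
  | .inl (g, false) => exact (hc [false]).append ((hc (encodeNat g)).append hP)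
  | .inr (g, true) => exact (hc [true]).append (((hc (encodeNat g)).append hQ).append hP)
  | .inr (g, false) => exact (hc [true]).append (((hc (encodeNat g)).append hP).append hQ)

theorem flatMap_filter_eq {α β : Type} (p : α → Prop) [DecidablePred p] (f : α → List β)
    (l : List α) :
    (l.filter p).flatMap f = l.flatMap fun x => if p x then f x else [] := by
  induction l with
  | nil => rfl
  | cons x l ih => by_cases h : p x <;> simp [h, ih]

/-- The code of one timestep. -/
theorem Emits.encodeLayer_treeEdges {d : ℕ} (hd : 2 ≤ d) (L : Letter a b) (c j : ℕ)
    {ν σ τ : (ℕ → ℕ) → ℕ} (hν : EmitsNat d ν) (hσ : EmitsNat d σ) (hτ : EmitsNat d τ) :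
    Emits d fun e => encodeLayer ((treeEdges (ν e) (σ e) c j (τ e)).map fun u =>
      L.instr (digitPoint k (σ e) u.1) (digitPoint k (σ e) u.2)) := by
  have hr : EmitsNat (d + 1) fun e => e d := .var (by omega) (by omega)
  have hσ' : EmitsNat (d + 1) σ := hσ.mono (by omega)
  have hp : EmitsNat (d + 1) fun e => (σ e + 1) ^ j := (hσ'.add (.const _ 1)).pow j
  have hu := ((hτ.mono (by omega : d ≤ d + 1)).mul hp).add hr
  have hbody := Emits.ite (by omega) ((((EmitsNat.const _ c).sub hu).add
      ((hu.add hp).sub (hν.mono (by omega)))).emits _ le_rfl (by omega))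
    ((Emits.singleton _ true).append (Emits.encodeInstr_instr L
      (Emits.encodePoint_digitPoint (k := k) (by omega) hσ' hu)
      (Emits.encodePoint_digitPoint (k := k) (by omega) hσ' (hu.add hp)))) (Emits.nil _)
  have hp' : EmitsNat d fun e => (σ e + 1) ^ j := (hσ.add (.const _ 1)).pow j
  have := ((hp'.emits d le_rfl hd).flatMap_range hd hbody).append (.singleton _ false)
  refine (congrArg (Emits d) (funext fun e => ?_)).mp this
  simp only [hσ.update _ _ _ le_rfl, hν.update _ _ _ le_rfl, hτ.update _ _ _ le_rfl,
    Function.update_self, encodeLayer, treeEdges, List.flatMap_map, flatMap_filter_eq,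
    Nat.add_eq_zero_iff, Nat.sub_eq_zero_iff_le, List.singleton_append]

theorem Emits.encode_wordLayers {d : ℕ} (hd : 2 ≤ d) (w : List (Letter a b)) (c j : ℕ)
    {ν σ τ : (ℕ → ℕ) → ℕ} (hν : EmitsNat d ν) (hσ : EmitsNat d σ) (hτ : EmitsNat d τ) :
    Emits d fun e => (wordLayers w ((treeEdges (ν e) (σ e) c j (τ e)).map
      (Prod.map (digitPoint k (σ e)) (digitPoint k (σ e))))).flatMap
        fun S => true :: encodeLayer S := by
  simp only [wordLayers, List.flatMap_map, List.map_map]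
  exact .flatMap_const _ fun L _ => (Emits.singleton _ true).append
    (Emits.encodeLayer_treeEdges hd L c j hν hσ hτ)

/-- Loop form of the code. The root is abstracted as `s` so that `Emits.letVar` can compute it once,
and the reversed pass becomes an increasing loop with layer index `s - 1 - t`. -/
theorem encodeCircuit_fanoutCircuit (w : List (Letter a b)) (n : ℕ) :
    encodeCircuit (fanoutCircuit k w n) =
      (fun s => ((List.range k).reverse.flatMap fun j => (List.range s).flatMap fun t =>
        (wordLayers w ((treeEdges n s 0 j (s - 1 - t)).map
          (Prod.map (digitPoint k s) (digitPoint k s)))).flatMap fun S => true :: encodeLayer S) ++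
      (((List.range k).flatMap fun j => (List.range s).flatMap fun t =>
        (wordLayers w ((treeEdges n s 1 j t).map
          (Prod.map (digitPoint k s) (digitPoint k s)))).flatMap fun S => true :: encodeLayer S) ++
      [false])) (floorRoot k n) := by
  have hrev : ∀ s, (List.range s).reverse = (List.range s).map fun t => s - 1 - t := fun s => by
    rw [List.range_eq_range', List.reverse_range', ← List.range_eq_range', zero_add]
  rw [encodeCircuit, fanoutCircuit, fanoutLayers, List.flatMap_assoc]
  simp only [treeLayers, List.reverse_flatMap, List.map_append, List.flatMap_append,
    List.flatMap_map, List.map_flatMap, List.flatMap_assoc, List.append_assoc,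
    Function.comp_def, ← List.map_reverse, hrev, List.map_map]

theorem Emits.encodeCircuit_fanoutCircuit (w : List (Letter a b)) :
    Emits 2 fun e => encodeCircuit (fanoutCircuit k w (e 0)) := by
  simp only [NANTC.encodeCircuit_fanoutCircuit]
  have hroot : Emits 2 fun e => List.replicate (floorRoot k (e 0)) true := by
    have hn : EmitsNat 3 fun e => e 0 := .var (by omega) (by omega)
    have hx : EmitsNat 3 fun e => e 2 := .var (by omega) (by omega)
    have := (Emits.var le_rfl (by omega : 0 < 2) (by omega)).flatMap_range le_rfl
      (Emits.ite (by omega) ((((hx.add (.const _ 1)).pow k).sub hn).emits 3 le_rfl (by omega))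
        (Emits.singleton _ true) (Emits.nil _))
    refine (congrArg (Emits 2) (funext fun e => ?_)).mp this
    simp only [Nat.sub_eq_zero_iff_le, Function.update_self,
      Function.update_of_ne (by omega : (0 : ℕ) ≠ 2), flatMap_ite_singleton, floorRoot]
  -- Register `0` holds the input, `2` the root and `3` the layer index; stack `1` is the output.
  -- The loops over `j` and over the letters of `w` have fixed length and are unrolled in the
  -- program.
  have hn : EmitsNat 4 fun e => e 0 := .var (by omega) (by omega)
  have hs : EmitsNat 4 fun e => e 2 := .var (by omega) (by omega)
  have ht : EmitsNat 4 fun e => e 3 := .var (by omega) (by omega)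
  have hloop : Emits 3 fun e => List.replicate (e 2) true :=
    .var (by omega) (by omega) (by omega)
  have hA := Emits.flatMap_const (List.range k).reverse fun j _ =>
    hloop.flatMap_range (by omega) (Emits.encode_wordLayers (k := k) (by omega) w 0 j hn hs
      ((hs.sub (.const _ 1)).sub ht))
  have hB := Emits.flatMap_const (List.range k) fun j _ =>
    hloop.flatMap_range (by omega) (Emits.encode_wordLayers (k := k) (by omega) w 1 j hn hs ht)
  have := hroot.letVar le_rfl (hA.append (hB.append (.singleton _ false)))
  refine (congrArg (Emits 2) (funext fun e => ?_)).mp this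
  simp [Function.update_of_ne]

theorem Emits.polyTimeFromSize {F : ℕ → List Bool} (h : Emits 2 fun e => F (e 0)) :
    PolyTimeFromSize F := by
  obtain ⟨p, P, hp⟩ := h
  refine ⟨p, P, fun n => ?_⟩
  obtain ⟨-, t, ht, hr⟩ := hp n (fun r => if r = 0 then n else 0) []
    (fun i => by split_ifs <;> omega)
    (fun i hi => if_neg (by omega))
  refine ⟨unaryStore (F n ++ []) fun r => if r = 0 then n else 0, t, ?_, ?_, ht⟩
  · convert hr using 1
    swap
    · simp
    funext r
    by_cases h0 : r = 0
    · simp [h0, initStore, unaryStore]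
    · simp [h0, initStore, unaryStore]
  · simp [unaryStore]

end Circuit

end NANTC

/-! ### The theorem. -/

theorem mainTheorem8 (k : ℕ) (hk : 1 ≤ k) (B : NANTC.GateSet) :
    ∃ C : NANTC.Family k B,
      (∀ n : ℕ, C.Implements n (NANTC.fanout n)) ∧
      ((fun n : ℕ => ((C.circuit n).depth : ℝ)) =O[atTop]
        (fun n : ℕ => (n : ℝ) ^ ((1 : ℝ) / (k : ℝ)))) ∧
      ((fun n : ℕ => ((C.circuit n).size : ℝ)) =O[atTop] (fun n : ℕ => (n : ℝ))) ∧
      ((fun n : ℕ => ((C.circuit n).width : ℝ)) =O[atTop] (fun n : ℕ => (n : ℝ))) := by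
  obtain ⟨a, b, G₁, G₂, w, hG₁, hG₂, hw⟩ := NANTC.exists_word_cnot B
  refine ⟨⟨a, b, G₁, G₂, hG₁, hG₂, NANTC.fanoutCircuit k w, NANTC.fanoutCircuit_isValid hk w,
    (NANTC.Emits.encodeCircuit_fanoutCircuit w).polyTimeFromSize⟩, fun n => ?_, ?_, ?_, ?_⟩
  · exact ⟨NANTC.fanoutLocation k n, NANTC.fanoutLocation_injective hk n,
      NANTC.run_fanoutCircuit hk hw n⟩
  -- Two passes, `k` digit positions, `w.length` timesteps per layer; the remaining factor of the
  -- depth is `floorRoot k n`.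
  · refine IsBigO.of_bound (2 * k * w.length) (Eventually.of_forall fun n => ?_)
    have hroot : (NANTC.floorRoot k n : ℝ) ≤ (n : ℝ) ^ ((1 : ℝ) / (k : ℝ)) := by
      have h : ((NANTC.floorRoot k n : ℝ)) ^ k ≤ n := by
        exact_mod_cast (NANTC.floorRoot_spec hk n).1
      have h2 := Real.rpow_le_rpow (by positivity) h (by positivity : 0 ≤ (1 : ℝ) / (k : ℝ))
      rwa [one_div, Real.pow_rpow_inv_natCast (by positivity) (by omega), ← one_div] at h2
    rw [Real.norm_of_nonneg (by positivity), Real.norm_of_nonneg (by positivity)]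
    simp only [NANTC.depth_fanoutCircuit]
    push_cast
    calc (2 * k * NANTC.floorRoot k n * w.length : ℝ)
        = 2 * k * w.length * NANTC.floorRoot k n := by ring
      _ ≤ _ := by gcongr
  · refine IsBigO.of_bound (2 * w.length) (Eventually.of_forall fun n => ?_)
    rw [Real.norm_of_nonneg (by positivity), Real.norm_of_nonneg (by positivity)]
    exact_mod_cast NANTC.size_fanoutCircuit_le w n
  · refine IsBigO.of_bound (2 * (2 * w.length)) (Eventually.of_forall fun n => ?_)
    rw [Real.norm_of_nonneg (by positivity), Real.norm_of_nonneg (by positivity)]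
    have h := (NANTC.width_le_two_mul_size (NANTC.fanoutCircuit k w n)).trans
      (Nat.mul_le_mul_left 2 (NANTC.size_fanoutCircuit_le w n))
    rw [← mul_assoc] at h
    exact_mod_cast h
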